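/- Let $A$ be a unital separable $C^*$-algebra and let $J\subset A$ be a closed (two-sided) ideal; put $U(J)=\{v\in U(A): v-1\in J\}$, where $U(A)$ is the unitary group of $A$. Let $A^\flat=C^b([0,\infty),A)/C_0([0,\infty),A)$, in which $A$ is embedded as the constant functions, and let $A_\flat=A^\flat\cap A'$. Let $G$ be a countable discrete group and let $(\alpha,u)$ be a cocycle action of $G$ on $A$, that is, maps $\alpha:G\to\mathrm{Aut}(A)$ and $u:G\times G\to U(A)$ with $$\alpha_g\circ\alpha_h=\mathrm{Ad}\,u(g,h)\circ\alpha_{gh},\qquad u(g,h)\,u(gh,k)=\alpha_g(u(h,k))\,u(g,hk)\qquad(g,h,k\in G).$$ Then $\alpha$ acts pointwise on representatives and induces a $G$-action on $A_\flat$; let $(A_\flat)^\alpha$ be its fixed point subalgebra. Suppose that $(A_\flat)^\alpha$ contains a unital copy of the Cuntz algebra $\mathcal O_\infty$, that is, there is an injective unital $*$-homomorphism $\mathcal O_\infty\to(A_\flat)^\alpha$. Then for every norm-continuous map $x:[0,1]\times[0,\infty)\to U(J)$ there exists a norm-continuous map $y:[0,1]\times[0,\infty)\to U(J)$ such that $$y(0,t)=x(0,t),\qquad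 y(1,t)=x(1,t),\qquad \mathrm{Lip}(y(\cdot,t))<25\pi\qquad\text{for all }t\in[0,\infty),$$ where $\mathrm{Lip}$ denotes the best Lipschitz constant on $[0,1]$ (in particular it is finite), $$\limsup_{t\to\infty}\sup_{s\in[0,1]}\|[y(s,t),a]\|\le 243\,\limsup_{t\to\infty}\sup_{s\in[0,1]}\|[x(s,t),a]\|\qquad\text{for all }a\in A,$$ and $$\limsup_{t\to\infty}\sup_{s\in[0,1]}\|\alpha_g(y(s,t))-y(s,t)\|\le 243\,\limsup_{t\to\infty}\sup_{s\in[0,1]}\|\alpha_g(x(s,t))-x(s,t)\|\qquad\text{for all }g\in G.$$ -/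

import Mathlib

open Filter Topology
open scoped NNReal BoundedContinuousFunction

noncomputable section

namespace FlatCentralizer

/-! ### The Cuntz algebra `𝓞_∞`

It is realised on `ℓ²(ℕ)` as the C*-algebra generated by the isometries `S i : e n ↦ e ⟨i, n⟩`, where
`⟨i, n⟩ = Nat.pair i n`; their ranges are pairwise orthogonal. -/

/-- The Hilbert space `ℓ²(ℕ)`. -/
abbrev Ell2 : Type := lp (fun _ : ℕ => ℂ) 2

/-- The standard orthonormal basis of `ℓ²(ℕ)`. -/
def stdBasis : HilbertBasis ℕ ℂ Ell2 := HilbertBasis.ofRepr (LinearIsometryEquiv.refl ℂ Ell2)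

lemma orthonormal_pair (i : ℕ) : Orthonormal ℂ (fun n : ℕ => stdBasis (Nat.pair i n)) :=
  stdBasis.orthonormal.comp (fun n => Nat.pair i n)
    (fun a b h => by simpa using h)

/-- The isometry `S i` of `ℓ²(ℕ)` with `S i (e n) = e (Nat.pair i n)`. -/
def cuntzIsometry (i : ℕ) : Ell2 →L[ℂ] Ell2 :=
  (orthonormal_pair i).orthogonalFamily.linearIsometry.toContinuousLinearMap

/-- The Cuntz algebra `𝓞_∞`: the norm closed `*`-algebra generated by the isometries `S i`. -/
def cuntzInfinity : StarSubalgebra ℂ (Ell2 →L[ℂ] Ell2) :=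
  (StarAlgebra.adjoin ℂ (Set.range cuntzIsometry)).topologicalClosure

/-- The `i`-th canonical generator of `𝓞_∞`. -/
def cuntzGenerator (i : ℕ) : cuntzInfinity :=
  ⟨cuntzIsometry i, StarSubalgebra.le_topologicalClosure _
    (StarAlgebra.subset_adjoin ℂ _ ⟨i, rfl⟩)⟩

lemma cuntzIsometry_stdBasis (i n : ℕ) :
    cuntzIsometry i (stdBasis n) = stdBasis (Nat.pair i n) := by
  have h : stdBasis n = lp.single 2 n (1 : ℂ) := by
    rw [← stdBasis.repr_symm_single]
    rfl
  rw [h]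
  simp [cuntzIsometry, OrthogonalFamily.linearIsometry_apply_single]

/-- The defining relations of `𝓞_∞`. -/
lemma star_cuntzGenerator_mul (i j : ℕ) :
    star (cuntzGenerator i) * cuntzGenerator j = if i = j then 1 else 0 := by
  apply Subtype.ext
  suffices h : star (cuntzIsometry i) * cuntzIsometry j =
      if i = j then (1 : Ell2 →L[ℂ] Ell2) else 0 by
    refine h.trans ?_
    split_ifs <;> rfl
  have hb : ∀ m n : ℕ, inner ℂ (stdBasis m) ((star (cuntzIsometry i) * cuntzIsometry j)
      (stdBasis n)) = inner ℂ (stdBasis m)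
        ((if i = j then (1 : Ell2 →L[ℂ] Ell2) else 0) (stdBasis n)) := by
    intro m n
    rw [mul_apply_eq_comp, ContinuousLinearMap.star_eq_adjoint,
      ContinuousLinearMap.adjoint_inner_right, cuntzIsometry_stdBasis, cuntzIsometry_stdBasis,
      orthonormal_iff_ite.mp stdBasis.orthonormal]
    split_ifs with h1 h2 h2 <;>
      simp_all [Nat.pair_eq_pair, orthonormal_iff_ite.mp stdBasis.orthonormal,
        stdBasis.orthonormal.1]
  refine ContinuousLinearMap.ext_on (s := Set.range stdBasis) ?_ ?_
  · exact Submodule.dense_iff_topologicalClosure_eq_top.mpr stdBasis.dense_span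
  · rintro _ ⟨n, rfl⟩
    apply stdBasis.repr.injective
    ext m
    rw [stdBasis.repr_apply_apply, stdBasis.repr_apply_apply]
    exact hb m n

/-! ### The algebras `A^♭` and `A_♭` -/

section Flat

variable (A : Type*) [CStarAlgebra A]

/-- `C^b([0,∞), A)`. -/
abbrev Cb : Type _ := ℝ≥0 →ᵇ A

/-- `C₀([0,∞), A)`, as an ideal of `C^b([0,∞), A)`. -/
def czero : Ideal (Cb A) where
  carrier := {f | Tendsto f atTop (𝓝 0)}
  add_mem' {f g} hf hg := by
    have h : Tendsto (fun t => f t + g t) atTop (𝓝 (0 + 0)) := Tendsto.add hf hg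
    rwa [add_zero] at h
  zero_mem' := tendsto_const_nhds
  smul_mem' f g hg := by
    refine squeeze_zero_norm (a := fun t => ‖f‖ * ‖g t‖) (fun t => ?_) ?_
    · exact (norm_mul_le _ _).trans (by gcongr; exact f.norm_coe_le_norm t)
    · simpa using (tendsto_norm_zero.comp hg).const_mul ‖f‖

instance czero_isTwoSided : (czero A).IsTwoSided where
  mul_mem_of_left {f} g hf := by
    refine squeeze_zero_norm (a := fun t => ‖f t‖ * ‖g‖) (fun t => ?_) ?_
    · exact (norm_mul_le _ _).trans (by gcongr; exact g.norm_coe_le_norm t)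
    · simpa using (tendsto_norm_zero.comp hf).mul_const ‖g‖

/-- `A^♭ = C^b([0,∞), A) / C₀([0,∞), A)`. -/
abbrev Flat : Type _ := Cb A ⧸ czero A

/-- The quotient map `C^b([0,∞), A) → A^♭`. -/
abbrev toFlat : Cb A →ₐ[ℂ] Flat A := Ideal.Quotient.mkₐ ℂ (czero A)

lemma star_mem_czero {f : Cb A} (hf : f ∈ czero A) : star f ∈ czero A := by
  have h : Tendsto (fun t => star (f t)) atTop (𝓝 (star 0)) := Tendsto.star hf
  rwa [star_zero] at h

/-- The involution of `A^♭`, induced by the pointwise one. -/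
instance flatStar : Star (Flat A) where
  star := Quotient.map' star (by
    intro f g h
    rw [Submodule.quotientRel_def] at h ⊢
    simpa using star_mem_czero A h)

lemma star_toFlat (f : Cb A) : star (toFlat A f) = toFlat A (star f) := rfl

instance flatStarRing : StarRing (Flat A) where
  star_involutive := by
    intro b
    obtain ⟨f, rfl⟩ := Ideal.Quotient.mkₐ_surjective ℂ (czero A) b
    simp only [star_toFlat, star_star]
  star_mul := by
    intro b c
    obtain ⟨f, rfl⟩ := Ideal.Quotient.mkₐ_surjective ℂ (czero A) b
    obtain ⟨g, rfl⟩ := Ideal.Quotient.mkₐ_surjective ℂ (czero A) c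
    simp only [← map_mul, star_toFlat, star_mul]
  star_add := by
    intro b c
    obtain ⟨f, rfl⟩ := Ideal.Quotient.mkₐ_surjective ℂ (czero A) b
    obtain ⟨g, rfl⟩ := Ideal.Quotient.mkₐ_surjective ℂ (czero A) c
    simp only [← map_add, star_toFlat, star_add]

instance flatStarModule : StarModule ℂ (Flat A) where
  star_smul := by
    intro z b
    obtain ⟨f, rfl⟩ := Ideal.Quotient.mkₐ_surjective ℂ (czero A) b
    simp only [← map_smul, star_toFlat, star_smul]

/-- `A_♭ = A^♭ ∩ A'`, where `A` is embedded in `A^♭` as the constant functions. -/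
def flatCentralizer : StarSubalgebra ℂ (Flat A) :=
  StarSubalgebra.centralizer ℂ
    (Set.range fun a : A => toFlat A (BoundedContinuousFunction.const ℝ≥0 a))

variable {A}

/-- The pointwise action of an automorphism of `A` on `C^b([0,∞), A)`. -/
def cbMap (φ : A ≃⋆ₐ[ℂ] A) : Cb A →⋆ₐ[ℂ] Cb A where
  toFun f := BoundedContinuousFunction.ofNormedAddCommGroup (fun t => φ (f t))
    ((NonUnitalStarAlgHom.isometry φ φ.injective).continuous.comp f.continuous) ‖f‖
    (fun t => (NonUnitalStarAlgHom.norm_map φ φ.injective (f t)).trans_le (f.norm_coe_le_norm t))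
  map_one' := by ext t; simp
  map_mul' f g := by ext t; simp
  map_zero' := by ext t; simp
  map_add' f g := by ext t; simp
  commutes' z := by ext t; simp [Algebra.algebraMap_eq_smul_one]
  map_star' f := by ext t; simp [map_star]

lemma cbMap_mem_czero (φ : A ≃⋆ₐ[ℂ] A) {f : Cb A} (hf : f ∈ czero A) :
    cbMap φ f ∈ czero A := by
  have hc := (NonUnitalStarAlgHom.isometry φ φ.injective).continuous.tendsto 0
  rw [map_zero] at hc
  exact hc.comp hf

/-- The `*`-endomorphism of `A^♭` induced by an automorphism of `A`. -/
def flatMap (φ : A ≃⋆ₐ[ℂ] A) : Flat A →⋆ₐ[ℂ] Flat A where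
  toAlgHom := Ideal.Quotient.liftₐ (czero A) ((toFlat A).comp (cbMap φ).toAlgHom)
    (fun f hf => Ideal.Quotient.eq_zero_iff_mem.mpr (cbMap_mem_czero φ hf))
  map_star' := by
    intro b
    obtain ⟨f, rfl⟩ := Ideal.Quotient.mkₐ_surjective ℂ (czero A) b
    exact congrArg (toFlat A) (map_star (cbMap φ) f)

lemma flatMap_toFlat (φ : A ≃⋆ₐ[ℂ] A) (f : Cb A) :
    flatMap φ (toFlat A f) = toFlat A (cbMap φ f) := rfl

end Flat

/-! ### Cocycle actions -/

/-- A cocycle action `(α, u) : G ↷ A` of a discrete group on a unital C*-algebra: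
`α g ∘ α h = Ad u(g,h) ∘ α (gh)` and `u(g,h) u(gh,k) = α g (u(h,k)) u(g,hk)`. -/
structure CocycleAction (G A : Type*) [Group G] [CStarAlgebra A] where
  α : G → (A ≃⋆ₐ[ℂ] A)
  u : G → G → unitary A
  comp_eq : ∀ (g h : G) (a : A), α g (α h a) = (u g h : A) * α (g * h) a * star (u g h : A)
  cocycle : ∀ g h k : G,
    (u g h : A) * (u (g * h) k : A) = α g (u h k : A) * (u g (h * k) : A)

/-- The fixed point algebra `(A_♭)^α`. -/
def CocycleAction.fixedFlat {G A : Type*} [Group G] [CStarAlgebra A] (c : CocycleAction G A) :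
    StarSubalgebra ℂ (Flat A) :=
  flatCentralizer A ⊓ ⨅ g : G, StarAlgHom.equalizer (flatMap (c.α g)) (StarAlgHom.id ℂ (Flat A))

lemma CocycleAction.mem_fixedFlat {G A : Type*} [Group G] [CStarAlgebra A]
    (c : CocycleAction G A) (b : Flat A) :
    b ∈ c.fixedFlat ↔ b ∈ flatCentralizer A ∧ ∀ g : G, flatMap (c.α g) b = b := by
  simp [CocycleAction.fixedFlat, StarSubalgebra.mem_inf, StarSubalgebra.mem_iInf]

/-- `U(J) = {v ∈ U(A) ; v - 1 ∈ J}` for an ideal `J` of a unital C*-algebra `A`. -/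
def idealUnitary {A : Type*} [CStarAlgebra A] (J : TwoSidedIdeal A) : Set A :=
  {v | v ∈ unitary A ∧ v - 1 ∈ J}

end FlatCentralizer

end

/-!
Write `amp V b = V b V* + (1 - V V*)` for an isometry `V`. The argument is an Eilenberg swindle inside
the asymptotic centralizer, followed by rotations of orthogonal projections into each other.

*Isometries.* Two generators of `𝓞_∞` lift, by polar decomposition, to continuous paths `S`, `T` of
isometries with orthogonal ranges which are asymptotically central and asymptotically fixed by the
action (`exists_central_isometries`). After a fast reparametrisation of time
(`exists_reparametrization`) the isometries also commute nearly with any prescribed path of elements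
of `A`, such as the endpoint `t ↦ u (1, t)` below.

*Swindle.* Normalise `u (s, t) = x (s, t) x (0, t)*`. At time `t`, let `u_0, u_1, …` be the values of
`u (⬝, t)` at the points `1, 1 - δ, 1 - 2δ, …`, continued by `u_j = 1`, where the mesh `δ = δ t` is so
fine that consecutive values are close. The diagonal unitary `Y` with entries `u_j` on the ranges of
the isometries `T ^ j S` satisfies `Y ≈ amp S u_0 * amp T Y` (`norm_swindle_sub_shift_le`), because
shifting a slowly varying diagonal hardly changes it. Since finitely many samples differ from `1` and
`δ` is continuous, `Y` is continuous in `t`.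

*Short paths.* For orthogonal isometries `V`, `W` the rotation of `V` into `W` gives a path of
Lipschitz constant `2π` from `1` to `amp V Y * star (amp W Y)` (`OrthoIsometries.rotPath_one`). Two of
them combine to a path `N` from `1` to `amp S Y * star (amp (S * T) Y) ≈ amp (S * S) u_0`. With
`V = S * S`, the unitary `w = u_0 * star (amp V u_0)` is nearly supported on the complement of the
range of `V`, and that complement is rotated into the range of `V`; this gives a path from `1` to
nearly `w * star (amp V w)`. Multiplying it by `N * star (amp V N) * N` gives a path from `1` to nearly
`u_0 = u (1, t)` (`norm_roughPath_one_sub_le`). A Cayley transform corrects the endpoint. Seven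
rotation paths are used, and the correction has Lipschitz constant at most `4`: in total
`14π + 4 < 25π`.

*Commutators.* Commutator norms and the displacements `‖α_g b - b‖` are treated together as seminorms
`p` with a Leibniz rule (`IsDefect`). The entries of the diagonal `Y` live on orthogonal ranges, so
`p Y` is bounded by the maximum of the `p u_j`, up to the defect of the isometries
(`IsDefect.swindle_le`). Counting factors, `p (y (s, t)) ≤ 33 sup_s p (x (s, t)) + o(1)`, and
`33 ≤ 243`. A diagonal choice handles countably many seminorms; separability of `A` and countability
of `G` make these sufficient.
-/

open Filter Topology
open scoped NNReal BoundedContinuousFunction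

namespace FlatCentralizer

variable {A : Type*} [CStarAlgebra A]

/-! ### Amplification along isometries -/

lemma one_mem_idealUnitary (J : TwoSidedIdeal A) : (1 : A) ∈ idealUnitary J :=
  ⟨one_mem _, by simp⟩

lemma mul_mem_idealUnitary {J : TwoSidedIdeal A} {b c : A} (hb : b ∈ idealUnitary J)
    (hc : c ∈ idealUnitary J) : b * c ∈ idealUnitary J := by
  refine ⟨mul_mem hb.1 hc.1, ?_⟩
  have h : b * c - 1 = b * (c - 1) + (b - 1) := by noncomm_ring
  rw [h]
  exact J.add_mem (J.mul_mem_left _ _ hc.2) hb.2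

lemma star_mem_idealUnitary {J : TwoSidedIdeal A} {b : A} (hb : b ∈ idealUnitary J) :
    star b ∈ idealUnitary J := by
  refine ⟨Unitary.star_mem hb.1, ?_⟩
  have h : star b - 1 = -(star b * (b - 1)) := by
    rw [mul_sub, (Unitary.mem_iff.mp hb.1).1]; noncomm_ring
  rw [h]
  exact J.neg_mem (J.mul_mem_left _ _ hb.2)

lemma norm_le_one_of_unitary {b : A} (hb : b ∈ unitary A) : ‖b‖ ≤ 1 := by
  nontriviality A
  exact (CStarRing.norm_of_mem_unitary hb).le

lemma norm_le_one_of_isometry {V : A} (hV : star V * V = 1) : ‖V‖ ≤ 1 := by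
  nontriviality A
  have h := CStarRing.norm_star_mul_self (x := V)
  rw [hV, CStarRing.norm_one] at h
  nlinarith [norm_nonneg V]

/-- The amplification `V b V* + (1 - V V*)` of `b` along `V`; for an isometry `V` this is a unital
`*`-homomorphism in `b`. -/
noncomputable def amp (V b : A) : A := 1 + V * (b - 1) * star V

@[simp] lemma amp_one (V : A) : amp V 1 = 1 := by simp [amp]

lemma amp_amp (V W b : A) : amp V (amp W b) = amp (V * W) b := by
  simp [amp, mul_assoc]

lemma star_amp (V b : A) : star (amp V b) = amp V (star b) := by
  simp [amp, mul_assoc]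

lemma amp_mul {V : A} (hV : star V * V = 1) (b c : A) : amp V (b * c) = amp V b * amp V c := by
  have hV' (x : A) : star V * (V * x) = x := by rw [← mul_assoc, hV, one_mul]
  simp only [amp, mul_add, add_mul, mul_sub, sub_mul, mul_assoc, mul_one, one_mul, hV']
  abel

lemma amp_mem_unitary {V b : A} (hV : star V * V = 1) (hb : b ∈ unitary A) :
    amp V b ∈ unitary A := by
  rw [Unitary.mem_iff] at hb ⊢
  rw [star_amp, ← amp_mul hV, ← amp_mul hV, hb.1, hb.2, amp_one]
  exact ⟨rfl, rfl⟩

lemma amp_mem_idealUnitary {J : TwoSidedIdeal A} {V b : A} (hV : star V * V = 1)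
    (hb : b ∈ idealUnitary J) : amp V b ∈ idealUnitary J := by
  refine ⟨amp_mem_unitary hV hb.1, ?_⟩
  rw [amp, add_sub_cancel_left]
  exact J.mul_mem_right _ _ (J.mul_mem_left _ _ hb.2)

lemma norm_conj_le {V : A} (hV : star V * V = 1) (x : A) : ‖V * x * star V‖ ≤ ‖x‖ := by
  have h1 := norm_le_one_of_isometry hV
  calc ‖V * x * star V‖ ≤ ‖V‖ * ‖x‖ * ‖star V‖ :=
        (norm_mul_le _ _).trans (by gcongr; exact norm_mul_le _ _)
    _ ≤ 1 * ‖x‖ * 1 := by rw [norm_star]; gcongr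
    _ = ‖x‖ := by ring

lemma norm_amp_sub_le {V : A} (hV : star V * V = 1) (b c : A) :
    ‖amp V b - amp V c‖ ≤ ‖b - c‖ := by
  have h : amp V b - amp V c = V * (b - c) * star V := by simp only [amp]; noncomm_ring
  rw [h]
  exact norm_conj_le hV _

/-- Two isometries with orthogonal ranges. -/
structure OrthoIsometries (V W : A) : Prop where
  left : star V * V = 1
  right : star W * W = 1
  ortho : star V * W = 0

lemma OrthoIsometries.ortho' {V W : A} (h : OrthoIsometries V W) : star W * V = 0 := by
  have := congrArg star h.ortho
  simpa using this

/-- The pair of isometries used in the second rotation: `W` and `V * W`. -/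
lemma OrthoIsometries.shift {V W : A} (h : OrthoIsometries V W) : OrthoIsometries W (V * W) where
  left := h.right
  right := by rw [star_mul, mul_assoc, ← mul_assoc (star V), h.left, one_mul, h.right]
  ortho := by rw [← mul_assoc, h.ortho', zero_mul]

/-- Summands sitting under orthogonal isometries contribute the maximum of their norms, because
`(x, y) ↦ V x V* + W y W*` is a `*`-homomorphism. -/
lemma OrthoIsometries.norm_add_le {V W : A} (h : OrthoIsometries V W) (x y : A) :
    ‖V * x * star V + W * y * star W‖ ≤ max ‖x‖ ‖y‖ := by
  have hV (z : A) : star V * (V * z) = z := by rw [← mul_assoc, h.left, one_mul]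
  have hW (z : A) : star W * (W * z) = z := by rw [← mul_assoc, h.right, one_mul]
  have hVW (z : A) : star V * (W * z) = 0 := by rw [← mul_assoc, h.ortho, zero_mul]
  have hWV (z : A) : star W * (V * z) = 0 := by rw [← mul_assoc, h.ortho', zero_mul]
  let φ : A × A →⋆ₙₐ[ℂ] A :=
    { toFun := fun z => V * z.1 * star V + W * z.2 * star W
      map_smul' := fun r z => by simp
      map_zero' := by simp
      map_add' := fun z z' => by simp only [Prod.fst_add, Prod.snd_add]; noncomm_ring
      map_mul' := fun z z' => by
        simp [mul_add, add_mul, mul_assoc, hV, hW, hVW, hWV]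
      map_star' := fun z => by simp [mul_assoc] }
  exact NonUnitalStarAlgHom.norm_apply_le φ (x, y)

lemma OrthoIsometries.amp_mul_amp {V W : A} (h : OrthoIsometries V W) (b c : A) :
    amp V b * amp W c = 1 + (V * (b - 1) * star V + W * (c - 1) * star W) := by
  have hVW (z : A) : star V * (W * z) = 0 := by rw [← mul_assoc, h.ortho, zero_mul]
  simp only [amp, mul_add, add_mul, mul_sub, sub_mul, mul_assoc, mul_one, one_mul, hVW, mul_zero]
  abel

lemma OrthoIsometries.norm_amp_mul_amp_sub_le {V W : A} (h : OrthoIsometries V W)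
    (b c b' c' : A) :
    ‖amp V b * amp W c - amp V b' * amp W c'‖ ≤ max ‖b - b'‖ ‖c - c'‖ := by
  have e : amp V b * amp W c - amp V b' * amp W c' =
      V * (b - b') * star V + W * (c - c') * star W := by
    rw [h.amp_mul_amp, h.amp_mul_amp]; noncomm_ring
  rw [e]
  exact h.norm_add_le _ _

/-! ### Rotation paths -/

/-- Rodrigues' formula for `exp (θ K)`, valid for the skew-adjoint `K` with `K ^ 3 = - K`. -/
noncomputable def rotation (K : A) (θ : ℝ) : A := 1 + (Real.sin θ • K + (1 - Real.cos θ) • (K * K))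

/-- Skew-adjoint partial isometries. -/
structure IsRotationGenerator (K : A) : Prop where
  star_eq : star K = -K
  cube : K * (K * K) = -K

namespace IsRotationGenerator

variable {K : A} (hK : IsRotationGenerator K)
include hK

lemma norm_le_one : ‖K‖ ≤ 1 := by
  have hq : IsStarProjection (star K * K) := by
    refine ⟨?_, .star_mul_self _⟩
    show star K * K * (star K * K) = star K * K
    rw [hK.star_eq]
    have : -K * K * (-K * K) = K * (K * (K * K)) := by noncomm_ring
    rw [this, hK.cube]
    noncomm_ring
  have h := hq.norm_le
  rw [CStarRing.norm_star_mul_self] at h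
  nlinarith [norm_nonneg K]

lemma star_rotation (θ : ℝ) : star (rotation K θ) = rotation K (-θ) := by
  simp [rotation, hK.star_eq]

lemma rotation_mul_neg (θ : ℝ) : rotation K θ * rotation K (-θ) = 1 := by
  have hsc := Real.sin_sq_add_cos_sq θ
  have e : rotation K θ * rotation K (-θ) = 1 + (2 * (1 - Real.cos θ) - (1 - Real.cos θ) ^ 2
      - Real.sin θ ^ 2) • (K * K) := by
    simp only [rotation, Real.sin_neg, Real.cos_neg, mul_add, add_mul, mul_one, one_mul,
      smul_mul_assoc, mul_smul_comm, mul_assoc, hK.cube, mul_neg]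
    module
  rw [e, show 2 * (1 - Real.cos θ) - (1 - Real.cos θ) ^ 2 - Real.sin θ ^ 2 = 0 by linarith,
    zero_smul, add_zero]

lemma rotation_mem_unitary (θ : ℝ) : rotation K θ ∈ unitary A := by
  rw [Unitary.mem_iff, hK.star_rotation]
  refine ⟨?_, hK.rotation_mul_neg θ⟩
  simpa using hK.rotation_mul_neg (-θ)

lemma norm_rotation_sub_le (θ θ' : ℝ) : ‖rotation K θ - rotation K θ'‖ ≤ 2 * |θ - θ'| := by
  have e : rotation K θ - rotation K θ' = (Real.sin θ - Real.sin θ') • K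
      + (Real.cos θ' - Real.cos θ) • (K * K) := by
    simp only [rotation]; module
  have h1 := hK.norm_le_one
  have h2 : ‖K * K‖ ≤ 1 := (norm_mul_le _ _).trans (by nlinarith [norm_nonneg K])
  have hs : |Real.sin θ - Real.sin θ'| ≤ |θ - θ'| := by
    simpa [Real.dist_eq] using Real.lipschitzWith_sin.dist_le_mul θ θ'
  have hc : |Real.cos θ' - Real.cos θ| ≤ |θ - θ'| := by
    rw [abs_sub_comm]
    simpa [Real.dist_eq] using Real.lipschitzWith_cos.dist_le_mul θ θ'
  rw [e]
  calc _ ≤ |Real.sin θ - Real.sin θ'| * ‖K‖ + |Real.cos θ' - Real.cos θ| * ‖K * K‖ := by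
        refine (norm_add_le _ _).trans ?_
        rw [norm_smul, norm_smul, Real.norm_eq_abs, Real.norm_eq_abs]
    _ ≤ |θ - θ'| * 1 + |θ - θ'| * 1 := by gcongr
    _ = _ := by ring

end IsRotationGenerator

@[simp] lemma rotation_zero (K : A) : rotation K 0 = 1 := by simp [rotation]

lemma rotation_pi_div_two (K : A) : rotation K (Real.pi / 2) = 1 + (K + K * K) := by
  simp [rotation]

/-- The path `s ↦ b R(s) b* R(s)*`, `R(s) = exp (s π/2 K)`, from `1` to `b (R(1) b R(1)*)*`. -/
noncomputable def rotPath (K b : A) (s : ℝ) : A :=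
  b * rotation K (s * (Real.pi / 2)) * star b * star (rotation K (s * (Real.pi / 2)))

lemma rotPath_zero {K b : A} (hb : b ∈ unitary A) : rotPath K b 0 = 1 := by
  simp [rotPath, (Unitary.mem_iff.mp hb).2]

lemma rotPath_one (K b : A) : rotPath K b 1 =
    b * star (rotation K (Real.pi / 2) * b * star (rotation K (Real.pi / 2))) := by
  simp [rotPath, mul_assoc]

lemma rotPath_mem {J : TwoSidedIdeal A} {K b : A} (hK : IsRotationGenerator K)
    (hb : b ∈ idealUnitary J) (s : ℝ) : rotPath K b s ∈ idealUnitary J := by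
  have hR := hK.rotation_mem_unitary (s * (Real.pi / 2))
  set R := rotation K (s * (Real.pi / 2)) with hRdef
  have h : R * star b * star R ∈ idealUnitary J := by
    refine ⟨mul_mem (mul_mem hR (Unitary.star_mem hb.1)) (Unitary.star_mem hR), ?_⟩
    have e : R * star b * star R - 1 = R * (star b - 1) * star R := by
      rw [mul_sub, sub_mul, mul_one, (Unitary.mem_iff.mp hR).2]
    rw [e]
    exact J.mul_mem_right _ _ (J.mul_mem_left _ _ (star_mem_idealUnitary hb).2)
  have := mul_mem_idealUnitary hb h
  rwa [← mul_assoc, ← mul_assoc] at this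

/-- Telescoping for contractions. -/
lemma norm_mul_sub_mul_le {b c b' c' : A} (hc : ‖c‖ ≤ 1) (hb' : ‖b'‖ ≤ 1) :
    ‖b * c - b' * c'‖ ≤ ‖b - b'‖ + ‖c - c'‖ := by
  have e : b * c - b' * c' = (b - b') * c + b' * (c - c') := by noncomm_ring
  rw [e]
  calc _ ≤ ‖b - b'‖ * ‖c‖ + ‖b'‖ * ‖c - c'‖ :=
        (norm_add_le _ _).trans (add_le_add (norm_mul_le _ _) (norm_mul_le _ _))
    _ ≤ ‖b - b'‖ * 1 + 1 * ‖c - c'‖ := by gcongr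
    _ = _ := by ring

lemma norm_rotPath_sub_le {K b : A} (hK : IsRotationGenerator K) (hb : b ∈ unitary A)
    (s s' : ℝ) : ‖rotPath K b s - rotPath K b s'‖ ≤ 2 * Real.pi * |s - s'| := by
  have h := hK.norm_rotation_sub_le (s * (Real.pi / 2)) (s' * (Real.pi / 2))
  have hR := hK.rotation_mem_unitary (s * (Real.pi / 2))
  have hR' := hK.rotation_mem_unitary (s' * (Real.pi / 2))
  have e : |s * (Real.pi / 2) - s' * (Real.pi / 2)| = |s - s'| * (Real.pi / 2) := by
    rw [← sub_mul, abs_mul, abs_of_pos (by positivity : 0 < Real.pi / 2)]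
  rw [e] at h
  unfold rotPath
  set R := rotation K (s * (Real.pi / 2))
  set R' := rotation K (s' * (Real.pi / 2))
  have h1 := norm_le_one_of_unitary hb
  have h2 := norm_le_one_of_unitary (Unitary.star_mem hb)
  calc _ ≤ ‖b * R * star b - b * R' * star b‖ + ‖star R - star R'‖ :=
        norm_mul_sub_mul_le (norm_le_one_of_unitary (Unitary.star_mem hR))
          (norm_le_one_of_unitary (mul_mem (mul_mem hb hR') (Unitary.star_mem hb)))
    _ ≤ (‖b * R - b * R'‖ + ‖star b - star b‖) + ‖R - R'‖ := by
        rw [← star_sub, norm_star]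
        gcongr
        exact norm_mul_sub_mul_le h2 (norm_le_one_of_unitary (mul_mem hb hR'))
    _ ≤ ((‖b - b‖ + ‖R - R'‖) + ‖star b - star b‖) + ‖R - R'‖ := by
        gcongr
        exact norm_mul_sub_mul_le (norm_le_one_of_unitary hR) h1
    _ = 2 * ‖R - R'‖ := by simp; ring
    _ ≤ _ := by linarith

/-- The generator rotating the range of `V` into the range of `W`. -/
def swapGenerator (V W : A) : A := W * star V - V * star W

section
variable {V W : A} (h : OrthoIsometries V W)
include h

lemma OrthoIsometries.isRotationGenerator : IsRotationGenerator (swapGenerator V W) := by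
  have hV (z : A) : star V * (V * z) = z := by rw [← mul_assoc, h.left, one_mul]
  have hW (z : A) : star W * (W * z) = z := by rw [← mul_assoc, h.right, one_mul]
  have hVW (z : A) : star V * (W * z) = 0 := by rw [← mul_assoc, h.ortho, zero_mul]
  have hWV (z : A) : star W * (V * z) = 0 := by rw [← mul_assoc, h.ortho', zero_mul]
  constructor
  · simp [swapGenerator]
  · simp only [swapGenerator, mul_sub, sub_mul, mul_assoc, hV, hW, hVW, hWV, mul_zero]
    abel

lemma OrthoIsometries.rotPath_one (b : A) :
    rotPath (swapGenerator V W) (amp V b) 1 = amp V b * star (amp W b) := by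
  rw [FlatCentralizer.rotPath_one, rotation_pi_div_two]
  congr 2
  have hR := h.isRotationGenerator.rotation_mem_unitary (Real.pi / 2)
  rw [rotation_pi_div_two] at hR
  have hRV : (1 + (swapGenerator V W + swapGenerator V W * swapGenerator V W)) * V = W := by
    have hV (z : A) : star V * (V * z) = z := by rw [← mul_assoc, h.left, one_mul]
    have hW (z : A) : star W * (W * z) = z := by rw [← mul_assoc, h.right, one_mul]
    have hVW (z : A) : star V * (W * z) = 0 := by rw [← mul_assoc, h.ortho, zero_mul]
    have hWV (z : A) : star W * (V * z) = 0 := by rw [← mul_assoc, h.ortho', zero_mul]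
    simp only [swapGenerator, add_mul, mul_sub, sub_mul, mul_assoc, hV, hW, hVW, hWV, mul_zero,
      h.left, h.ortho', mul_one, one_mul, zero_mul]
    abel
  set R := 1 + (swapGenerator V W + swapGenerator V W * swapGenerator V W) with hRdef
  have e : R * amp V b * star R = R * star R + (R * V) * (b - 1) * star (R * V) := by
    simp only [amp, star_mul]; noncomm_ring
  rw [e, hRV, (Unitary.mem_iff.mp hR).2, amp]

end

/-- The generator rotating the complement `e = 1 - V V*` of the range of `V` into `V e V*`. -/
noncomputable def cornerGenerator (V : A) : A := V * (1 - V * star V) - (1 - V * star V) * star V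

section
variable {V : A} (hV : star V * V = 1)
include hV

lemma star_mul_range_compl : star V * (1 - V * star V) = 0 := by
  rw [mul_sub, ← mul_assoc, hV]; simp

lemma range_compl_mul : (1 - V * star V) * V = 0 := by
  rw [sub_mul, mul_assoc, hV]; simp

lemma range_compl_mul_self : (1 - V * star V) * (1 - V * star V) = 1 - V * star V := by
  rw [mul_sub, ← mul_assoc, range_compl_mul hV]; simp

lemma norm_range_compl_le : ‖1 - V * star V‖ ≤ 1 := by
  have : IsStarProjection (1 - V * star V) :=
    ⟨range_compl_mul_self hV, by simp [IsSelfAdjoint]⟩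
  exact this.norm_le

lemma cornerGenerator_mul_self : cornerGenerator V * cornerGenerator V =
    -(V * (1 - V * star V) * star V + (1 - V * star V)) := by
  have h1 := star_mul_range_compl hV
  have h2 := range_compl_mul hV
  have h3 := range_compl_mul_self hV
  unfold cornerGenerator
  set e := 1 - V * star V
  have h1' (x : A) : star V * (e * x) = 0 := by rw [← mul_assoc, h1, zero_mul]
  have h2' (x : A) : e * (V * x) = 0 := by rw [← mul_assoc, h2, zero_mul]
  have h3' (x : A) : e * (e * x) = e * x := by rw [← mul_assoc, h3]
  have h4' (x : A) : star V * (V * x) = x := by rw [← mul_assoc, hV, one_mul]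
  simp only [mul_sub, sub_mul, mul_assoc, h1', h2', h3', h4', h3, mul_zero]
  abel

lemma isRotationGenerator_cornerGenerator : IsRotationGenerator (cornerGenerator V) := by
  constructor
  · simp [cornerGenerator]
  · rw [cornerGenerator_mul_self hV]
    have h1 := star_mul_range_compl hV
    have h2 := range_compl_mul hV
    have h3 := range_compl_mul_self hV
    unfold cornerGenerator
    set e := 1 - V * star V
    have h2' (x : A) : e * (V * x) = 0 := by rw [← mul_assoc, h2, zero_mul]
    have h3' (x : A) : e * (e * x) = e * x := by rw [← mul_assoc, h3]
    have h4' (x : A) : star V * (V * x) = x := by rw [← mul_assoc, hV, one_mul]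
    simp only [sub_mul, mul_add, mul_neg, mul_assoc, h2', h3', h4', h1, h3, mul_zero]
    abel

/-- If `w` is nearly the identity on the range of `V`, then rotating `w` into the range of `V` gives
nearly the amplification of `w` along `V`. -/
lemma norm_corner_conj_sub_amp_le {w : A} (hw : w ∈ unitary A) {η : ℝ} (h : ‖w * V - V‖ ≤ η) :
    ‖rotation (cornerGenerator V) (Real.pi / 2) * w *
      star (rotation (cornerGenerator V) (Real.pi / 2)) - amp V w‖ ≤ 4 * η := by
  have hR := (isRotationGenerator_cornerGenerator hV).rotation_mem_unitary (Real.pi / 2)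
  have hRe : rotation (cornerGenerator V) (Real.pi / 2) * (1 - V * star V) =
      V * (1 - V * star V) := by
    rw [rotation_pi_div_two, cornerGenerator_mul_self hV]
    have h1 := star_mul_range_compl hV
    have h3 := range_compl_mul_self hV
    unfold cornerGenerator
    set e := 1 - V * star V
    simp only [add_mul, sub_mul, neg_mul, mul_assoc, h1, h3, mul_zero, one_mul]
    abel
  set R := rotation (cornerGenerator V) (Real.pi / 2)
  have hV1 := norm_le_one_of_isometry hV
  have he1 := norm_range_compl_le hV
  have hes : star (1 - V * star V) = 1 - V * star V := by simp
  obtain ⟨e, he⟩ : ∃ e, e = 1 - V * star V := ⟨_, rfl⟩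
  rw [← he] at hRe he1 hes
  have hRe' : e * star R = e * star V := by
    have := congrArg star hRe
    rwa [star_mul, star_mul, hes] at this
  -- `x` is the part of `w - 1` that is not supported on the complement of the range of `V`
  obtain ⟨x, hx⟩ : ∃ x, x = (w - 1) - e * (w - 1) * e := ⟨_, rfl⟩
  have hw1 : ‖star V * (w - 1)‖ ≤ η := by
    have e1 : star V * (w - 1) = -(star (w * V - V) * w) := by
      have := (Unitary.mem_iff.mp hw).1
      rw [star_sub, star_mul, sub_mul, mul_assoc, this]
      noncomm_ring
    rw [e1, norm_neg]
    calc _ ≤ ‖star (w * V - V)‖ * ‖w‖ := norm_mul_le _ _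
      _ ≤ ‖w * V - V‖ * 1 := by
        rw [norm_star]; gcongr; exact norm_le_one_of_unitary hw
      _ ≤ η := by linarith
  have hxn : ‖x‖ ≤ 2 * η := by
    have e1 : x = V * (star V * (w - 1)) + e * ((w * V - V) * star V) := by
      rw [hx, he]; noncomm_ring
    rw [e1]
    calc _ ≤ ‖V‖ * ‖star V * (w - 1)‖ + ‖e‖ * (‖w * V - V‖ * ‖star V‖) := by
          refine (norm_add_le _ _).trans (add_le_add (norm_mul_le _ _)
            ((norm_mul_le _ _).trans ?_))
          gcongr; exact norm_mul_le _ _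
      _ ≤ 1 * η + 1 * (η * 1) := by
          have := (norm_nonneg _).trans h
          rw [norm_star]; gcongr
      _ = _ := by ring
  have key : R * w * star R - amp V w = R * x * star R - V * x * star V := by
    have e1 : R * w * star R = R * star R + R * (w - 1) * star R := by noncomm_ring
    have e2 : R * x * star R = R * (w - 1) * star R - (R * e) * (w - 1) * (e * star R) := by
      rw [hx]; noncomm_ring
    rw [e1, e2, hRe, hRe', (Unitary.mem_iff.mp hR).2, hx, amp]
    noncomm_ring
  rw [key]
  calc _ ≤ ‖x‖ + ‖x‖ := by
        refine (norm_sub_le _ _).trans (add_le_add ?_ (norm_conj_le hV x))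
        calc _ ≤ ‖R‖ * ‖x‖ * ‖star R‖ := (norm_mul_le _ _).trans (by gcongr; exact norm_mul_le _ _)
          _ ≤ 1 * ‖x‖ * 1 := by
            gcongr
            · exact norm_le_one_of_unitary hR
            · exact norm_le_one_of_unitary (Unitary.star_mem hR)
          _ = ‖x‖ := by ring
    _ ≤ _ := by linarith

/-- `u ∙ amp V u*` is nearly the identity on the range of `V` when `u` nearly commutes with `V`. -/
lemma norm_mul_star_amp_mul_sub_le {u : A} (hu : u ∈ unitary A) :
    ‖u * star (amp V u) * V - V‖ ≤ ‖u * V - V * u‖ := by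
  have e : u * star (amp V u) * V - V = (u * V - V * u) * star u := by
    have h1 : star (amp V u) * V = V * star u := by
      rw [star_amp, amp, add_mul, mul_assoc _ (star V), hV]; noncomm_ring
    rw [mul_assoc, h1, sub_mul, mul_assoc V, (Unitary.mem_iff.mp hu).2]; noncomm_ring
  rw [e]
  calc _ ≤ ‖u * V - V * u‖ * ‖star u‖ := norm_mul_le _ _
    _ ≤ ‖u * V - V * u‖ * 1 := by
      gcongr; exact norm_le_one_of_unitary (Unitary.star_mem hu)
    _ = _ := mul_one _

end

/-! ### The swindle -/

/-- The diagonal unitary with entry `u j` on the range of the isometry `T ^ j * S` for `j < n`. -/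
noncomputable def swindle (S T : A) : ℕ → (ℕ → A) → A
  | 0, _ => 1
  | n + 1, u => amp S (u 0) * amp T (swindle S T n fun j => u (j + 1))

section
variable {S T : A} (h : OrthoIsometries S T)
include h

lemma swindle_mem {J : TwoSidedIdeal A} (n : ℕ) {u : ℕ → A} (hu : ∀ j, u j ∈ idealUnitary J) :
    swindle S T n u ∈ idealUnitary J := by
  induction n generalizing u with
  | zero => exact one_mem_idealUnitary J
  | succ n ih =>
    exact mul_mem_idealUnitary (amp_mem_idealUnitary h.left (hu 0))
      (amp_mem_idealUnitary h.right (ih fun j => hu (j + 1)))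

lemma norm_swindle_sub_le (n : ℕ) {u v : ℕ → A} {ε : ℝ} (hε : 0 ≤ ε)
    (huv : ∀ j, ‖u j - v j‖ ≤ ε) : ‖swindle S T n u - swindle S T n v‖ ≤ ε := by
  induction n generalizing u v with
  | zero => simpa [swindle] using hε
  | succ n ih =>
    exact (h.norm_amp_mul_amp_sub_le _ _ _ _).trans
      (max_le (huv 0) (ih fun j => huv (j + 1)))

omit h in
lemma swindle_succ_eq (n : ℕ) {u : ℕ → A} (hu : ∀ j, n ≤ j → u j = 1) :
    swindle S T (n + 1) u = swindle S T n u := by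
  induction n generalizing u with
  | zero => simp [swindle, hu]
  | succ n ih => rw [swindle, ih fun j hj => hu (j + 1) (by omega), ← swindle]

omit h in
lemma swindle_eq_of_le {m n : ℕ} (hmn : m ≤ n) {u : ℕ → A} (hu : ∀ j, m ≤ j → u j = 1) :
    swindle S T n u = swindle S T m u := by
  induction n, hmn using Nat.le_induction with
  | base => rfl
  | succ n hmn ih => rw [swindle_succ_eq n fun j hj => hu j (hmn.trans hj), ih]

/-- Shifting a slowly varying diagonal by one place changes it little; this is the swindle. -/
lemma norm_swindle_sub_shift_le (n : ℕ) {u : ℕ → A} {ε : ℝ} (hε : 0 ≤ ε)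
    (hu : ∀ j, n ≤ j → u j = 1) (huu : ∀ j, ‖u (j + 1) - u j‖ ≤ ε) :
    ‖swindle S T n u - amp S (u 0) * amp T (swindle S T n u)‖ ≤ ε := by
  have e : swindle S T n u = amp S (u 0) * amp T (swindle S T n fun j => u (j + 1)) :=
    (swindle_succ_eq n hu).symm
  calc _ = ‖amp S (u 0) * amp T (swindle S T n fun j => u (j + 1))
        - amp S (u 0) * amp T (swindle S T n u)‖ := by rw [← e]
    _ ≤ ε := ?_
  refine (h.norm_amp_mul_amp_sub_le _ _ _ _).trans (max_le ?_ ?_)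
  · simpa using hε
  · exact norm_swindle_sub_le h n hε huu

end

lemma continuous_amp {X : Type*} [TopologicalSpace X] {V b : X → A} (hV : Continuous V)
    (hb : Continuous b) : Continuous fun t => amp (V t) (b t) := by
  unfold amp; fun_prop

lemma continuous_rotPath {X : Type*} [TopologicalSpace X] {K b : X → A} {s : X → ℝ}
    (hK : Continuous K) (hb : Continuous b) (hs : Continuous s) :
    Continuous fun t => rotPath (K t) (b t) (s t) := by
  unfold rotPath rotation; fun_prop

lemma continuous_swindle {X : Type*} [TopologicalSpace X] {S T : X → A} (hS : Continuous S)
    (hT : Continuous T) (n : ℕ) {u : X → ℕ → A} (hu : ∀ j, Continuous fun t => u t j) :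
    Continuous fun t => swindle (S t) (T t) n (u t) := by
  induction n generalizing u with
  | zero => exact continuous_const
  | succ n ih =>
    exact (continuous_amp hS (hu 0)).mul (continuous_amp hT (ih fun j => hu (j + 1)))

/-! ### Short paths near the identity -/

/-- The Cayley path `((1 - s) + (1 + s) z) ((1 + s) + (1 - s) z)⁻¹` from `1` to `z`, for a unitary
`z` close to `1`, written so that its membership in `1 + J` is visible. -/
noncomputable def cayleyPath (z : A) (s : ℝ) : A :=
  1 + (2 * s) • ((z - 1) * Ring.inverse ((2 : ℝ) • (1 : A) + (1 - s) • (z - 1)))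

section
variable {z : A} {ε : ℝ} (hε : ε ≤ 1) (hzε : ‖z - 1‖ ≤ ε) {s : ℝ}

@[simp] lemma cayleyPath_zero : cayleyPath z 0 = 1 := by simp [cayleyPath]

lemma inverse_two_smul_one : Ring.inverse ((2 : ℝ) • (1 : A)) = (2 : ℝ)⁻¹ • (1 : A) := by
  exact Ring.inverse_unit ⟨(2 : ℝ) • (1 : A), (2 : ℝ)⁻¹ • (1 : A), by simp, by simp⟩

lemma cayleyPath_one : cayleyPath z 1 = z := by
  simp [cayleyPath, inverse_two_smul_one]

include hε hzε

lemma isUnit_cayley_denom (hs : s ∈ Set.Icc (0 : ℝ) 1) :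
    IsUnit ((2 : ℝ) • (1 : A) + (1 - s) • (z - 1)) := by
  have e : (2 : ℝ) • (1 : A) + (1 - s) • (z - 1) =
      (2 : ℝ) • (1 - (-((1 - s) / 2)) • (z - 1)) := by module
  rw [e]
  refine IsUnit.smul (Units.mk0 (2 : ℝ) two_ne_zero) (isUnit_one_sub_of_norm_lt_one ?_)
  rw [norm_smul, Real.norm_eq_abs, abs_neg, abs_of_nonneg (by linarith [hs.2])]
  nlinarith [hs.1, hs.2, norm_nonneg (z - 1)]

lemma norm_inverse_cayley_denom_le (hs : s ∈ Set.Icc (0 : ℝ) 1) :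
    ‖Ring.inverse ((2 : ℝ) • (1 : A) + (1 - s) • (z - 1))‖ ≤ 1 := by
  have hu := isUnit_cayley_denom hε hzε hs
  have h := Ring.mul_inverse_cancel _ hu
  set B := Ring.inverse ((2 : ℝ) • (1 : A) + (1 - s) • (z - 1))
  have e : (2 : ℝ) • B = 1 - (1 - s) • ((z - 1) * B) := by
    rw [add_mul, smul_mul_assoc, smul_mul_assoc, one_mul] at h
    exact eq_sub_of_add_eq h
  have h1 : ‖(2 : ℝ) • B‖ ≤ 1 + ‖B‖ := by
    rw [e]
    refine (norm_sub_le _ _).trans (add_le_add (norm_le_one_of_unitary (one_mem _)) ?_)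
    rw [norm_smul, Real.norm_eq_abs, abs_of_nonneg (by linarith [hs.2])]
    calc _ ≤ 1 * (1 * ‖B‖) := by
          have := hs.1
          gcongr
          · linarith
          · exact (norm_mul_le _ _).trans (by gcongr; linarith)
      _ = _ := by ring
  rw [norm_smul] at h1
  norm_num at h1
  linarith

lemma norm_cayleyPath_sub_one_le (hs : s ∈ Set.Icc (0 : ℝ) 1) :
    ‖cayleyPath z s - 1‖ ≤ 2 * ε := by
  rw [cayleyPath, add_sub_cancel_left, norm_smul, Real.norm_eq_abs,
    abs_of_nonneg (by linarith [hs.1])]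
  have h0 := (norm_nonneg _).trans hzε
  calc _ ≤ (2 * 1) * (ε * 1) := by
        have := hs.2
        gcongr
        exact (norm_mul_le _ _).trans
          (mul_le_mul hzε (norm_inverse_cayley_denom_le hε hzε hs) (norm_nonneg _) h0)
    _ = _ := by ring

lemma norm_cayleyPath_sub_le {s' : ℝ} (hs : s ∈ Set.Icc (0 : ℝ) 1) (hs' : s' ∈ Set.Icc (0 : ℝ) 1) :
    ‖cayleyPath z s - cayleyPath z s'‖ ≤ 4 * |s - s'| := by
  have hB := norm_inverse_cayley_denom_le hε hzε hs
  have hB' := norm_inverse_cayley_denom_le hε hzε hs'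
  have h1 := Ring.inverse_mul_cancel _ (isUnit_cayley_denom hε hzε hs)
  have h2 := Ring.mul_inverse_cancel _ (isUnit_cayley_denom hε hzε hs')
  unfold cayleyPath
  set m := z - 1 with hm
  set B := Ring.inverse ((2 : ℝ) • (1 : A) + (1 - s) • m)
  set B' := Ring.inverse ((2 : ℝ) • (1 : A) + (1 - s') • m)
  have e1 : B - B' = (s - s') • (B * m * B') := by
    have e2 : B - B' = B * (((2 : ℝ) • (1 : A) + (1 - s') • m) * B')
        - (B * ((2 : ℝ) • (1 : A) + (1 - s) • m)) * B' := by rw [h1, h2]; simp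
    rw [e2]
    simp only [mul_add, add_mul, smul_mul_assoc, mul_smul_comm, mul_assoc, one_mul]
    module
  have e3 : (1 + (2 * s) • (m * B)) - (1 + (2 * s') • (m * B')) =
      (2 * (s - s')) • (m * B + s' • (m * (B * m * B'))) := by
    have : m * B = m * B' + (s - s') • (m * (B * m * B')) := by
      rw [← mul_smul_comm, ← e1]; noncomm_ring
    rw [this]; module
  have h0 := (norm_nonneg _).trans hzε
  have hm1 : ‖m‖ ≤ 1 := hzε.trans hε
  have hmB : ‖m * B‖ ≤ 1 := (norm_mul_le _ _).trans (mul_le_one₀ hm1 (norm_nonneg _) hB)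
  have hBmB : ‖m * (B * m * B')‖ ≤ 1 := by
    refine (norm_mul_le _ _).trans (mul_le_one₀ hm1 (norm_nonneg _) ?_)
    refine (norm_mul_le _ _).trans (mul_le_one₀ ?_ (norm_nonneg _) hB')
    exact (norm_mul_le _ _).trans (mul_le_one₀ hB (norm_nonneg _) hm1)
  rw [e3, norm_smul, Real.norm_eq_abs, abs_mul, abs_two]
  calc _ ≤ 2 * |s - s'| * (1 + 1 * 1) := by
        gcongr
        refine (norm_add_le _ _).trans (add_le_add hmB ?_)
        rw [norm_smul, Real.norm_eq_abs, abs_of_nonneg hs'.1]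
        have := hs'.2
        gcongr
    _ = _ := by ring

lemma cayleyPath_mem {J : TwoSidedIdeal A} (hz : z ∈ idealUnitary J)
    (hs : s ∈ Set.Icc (0 : ℝ) 1) : cayleyPath z s ∈ idealUnitary J := by
  refine ⟨?_, ?_⟩
  · have hu := isUnit_cayley_denom hε hzε hs
    have h1 := Ring.inverse_mul_cancel _ hu
    have h2 := Ring.mul_inverse_cancel _ hu
    obtain ⟨hz1, hz2⟩ := Unitary.mem_iff.mp hz.1
    unfold cayleyPath
    obtain ⟨m, hm⟩ : ∃ m, m = z - 1 := ⟨_, rfl⟩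
    have hm1 : star m * m = -(m + star m) := by
      rw [hm]; simp only [star_sub, star_one, mul_sub, sub_mul, hz1]; noncomm_ring
    have hm2 : m * star m = -(m + star m) := by
      rw [hm]; simp only [star_sub, star_one, mul_sub, sub_mul, hz2]; noncomm_ring
    rw [← hm] at h1 h2 ⊢
    obtain ⟨b, hb⟩ : ∃ b, b = (2 : ℝ) • (1 : A) + (1 - s) • m := ⟨_, rfl⟩
    rw [← hb] at h1 h2 ⊢
    set B := Ring.inverse b
    obtain ⟨a, ha⟩ : ∃ a, a = (2 : ℝ) • (1 : A) + (1 + s) • m := ⟨_, rfl⟩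
    have hab : a * b = b * a := by
      rw [ha, hb]
      simp only [mul_add, add_mul, smul_mul_assoc, mul_smul_comm, one_mul, mul_one]
      module
    -- the numerator `a` and the denominator `b` have the same modulus
    have hst : star a * a = star b * b := by
      rw [ha, hb]
      simp only [mul_add, add_mul, smul_mul_assoc, mul_smul_comm, one_mul, mul_one, star_add,
        star_smul, star_one, star_trivial, hm1]
      module
    have hst' : a * star a = b * star b := by
      rw [ha, hb]
      simp only [mul_add, add_mul, smul_mul_assoc, mul_smul_comm, one_mul, mul_one, star_add,
        star_smul, star_one, star_trivial, hm2]
      module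
    have hc : 1 + (2 * s) • (m * B) = a * B := by
      rw [← h2, ← smul_mul_assoc, ← add_mul, ha, hb]
      congr 1; module
    have hc' : a * B = B * a := by
      calc a * B = B * b * (a * B) := by rw [h1, one_mul]
        _ = B * (b * a) * B := by noncomm_ring
        _ = B * a * (b * B) := by rw [← hab]; noncomm_ring
        _ = B * a := by rw [h2, mul_one]
    rw [hc, Unitary.mem_iff]
    constructor
    · calc star (a * B) * (a * B) = star B * (star a * a) * B := by rw [star_mul]; noncomm_ring
        _ = star (b * B) * (b * B) := by rw [hst, star_mul]; noncomm_ring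
        _ = 1 := by rw [h2]; simp
    · rw [hc']
      calc B * a * star (B * a) = B * (a * star a) * star B := by rw [star_mul]; noncomm_ring
        _ = (B * b) * star (B * b) := by rw [hst', star_mul]; noncomm_ring
        _ = 1 := by rw [h1]; simp
  · rw [cayleyPath, add_sub_cancel_left, ← smul_mul_assoc]
    refine J.mul_mem_right _ _ ?_
    rw [← smul_one_mul]
    exact J.mul_mem_left _ _ hz.2

end

lemma continuous_cayleyPath {X : Type*} [TopologicalSpace X] {z : X → A} {s : X → ℝ}
    (hz : Continuous z) (hs : Continuous s) (hz1 : ∀ t, ‖z t - 1‖ ≤ 1)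
    (hs1 : ∀ t, s t ∈ Set.Icc (0 : ℝ) 1) : Continuous fun t => cayleyPath (z t) (s t) := by
  unfold cayleyPath
  have h : Continuous fun t => Ring.inverse ((2 : ℝ) • (1 : A) + (1 - s t) • (z t - 1)) := by
    refine continuous_iff_continuousAt.mpr fun t => ?_
    obtain ⟨v, hv⟩ := isUnit_cayley_denom le_rfl (hz1 t) (hs1 t)
    have h1 : ContinuousAt (fun t => (2 : ℝ) • (1 : A) + (1 - s t) • (z t - 1)) t := by
      fun_prop
    refine ContinuousAt.comp (g := Ring.inverse) ?_ h1
    rw [← hv]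
    exact NormedRing.inverse_continuousAt v
  fun_prop

/-! ### Defect seminorms -/

/-- A bounded seminorm satisfying the Leibniz rule and invariant under the involution, which moreover
does not add up along orthogonal isometries of small defect. It measures how far elements are from
being central, or from being fixed by an automorphism. -/
structure IsDefect (p : A → ℝ) : Prop where
  nonneg : ∀ x, 0 ≤ p x
  add_le : ∀ x y, p (x + y) ≤ p x + p y
  smul_le : ∀ (r : ℝ) x, p (r • x) ≤ |r| * p x
  one : p 1 = 0
  star_eq : ∀ x, p (star x) = p x
  mul_le : ∀ x y, p (x * y) ≤ ‖x‖ * p y + p x * ‖y‖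
  bounded : ∃ C, 0 ≤ C ∧ ∀ x, p x ≤ C * ‖x‖
  amp_mul_amp_le : ∀ {V W : A}, OrthoIsometries V W → ∀ {b c : A}, b ∈ unitary A → c ∈ unitary A →
    p (amp V b * amp W c) ≤ max (p b) (p c) + 4 * (p V + p W)

lemma norm_sub_one_le_two {b : A} (hb : b ∈ unitary A) : ‖b - 1‖ ≤ 2 := by
  have := (norm_sub_le b 1).trans
    (add_le_add (norm_le_one_of_unitary hb) (norm_le_one_of_unitary (one_mem _)))
  linarith

lemma norm_mul_three_le (x y z : A) : ‖x * y * z‖ ≤ ‖x‖ * ‖y‖ * ‖z‖ :=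
  (norm_mul_le _ _).trans (by gcongr; exact norm_mul_le _ _)

/-- The size of the commutators of `a` with `x` and `x*`. The second one makes this invariant under
`x ↦ x*`; for unitary `x` the two agree. -/
noncomputable def commutatorDefect (a x : A) : ℝ :=
  max ‖x * a - a * x‖ ‖star x * a - a * star x‖

lemma norm_commutator_amp_mul_amp_le (a : A) {V W : A} (h : OrthoIsometries V W) {b c : A}
    (hb : b ∈ unitary A) (hc : c ∈ unitary A) :
    ‖amp V b * amp W c * a - a * (amp V b * amp W c)‖ ≤
      max ‖b * a - a * b‖ ‖c * a - a * c‖ +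
        4 * (commutatorDefect a V + commutatorDefect a W) := by
  have aux : ∀ {V b : A}, star V * V = 1 → b ∈ unitary A →
      ‖(V * a - a * V) * (b - 1) * star V + V * (b - 1) * (star V * a - a * star V)‖ ≤
        4 * commutatorDefect a V := by
    intro V b hV hb
    have h1 : ‖V * a - a * V‖ ≤ commutatorDefect a V := le_max_left _ _
    have h2 : ‖star V * a - a * star V‖ ≤ commutatorDefect a V := le_max_right _ _
    have h3 := norm_sub_one_le_two hb
    have h4 := norm_le_one_of_isometry hV
    have h0 := (norm_nonneg _).trans h1
    calc _ ≤ commutatorDefect a V * 2 * 1 + 1 * 2 * commutatorDefect a V := by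
          refine (norm_add_le _ _).trans (add_le_add ((norm_mul_three_le _ _ _).trans ?_)
            ((norm_mul_three_le _ _ _).trans ?_))
          · rw [norm_star]; gcongr
          · gcongr
      _ = _ := by ring
  have e : amp V b * amp W c * a - a * (amp V b * amp W c) =
      (V * (b * a - a * b) * star V + W * (c * a - a * c) * star W) +
      (((V * a - a * V) * (b - 1) * star V + V * (b - 1) * (star V * a - a * star V)) +
      ((W * a - a * W) * (c - 1) * star W + W * (c - 1) * (star W * a - a * star W))) := by
    rw [h.amp_mul_amp]; noncomm_ring
  rw [e]
  refine (norm_add_le _ _).trans (add_le_add (h.norm_add_le _ _) ((norm_add_le _ _).trans ?_))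
  linarith [aux h.left hb, aux h.right hc]

lemma OrthoIsometries.amp_comm {V W : A} (h : OrthoIsometries V W) (b c : A) :
    amp W c * amp V b = amp V b * amp W c := by
  have h' : OrthoIsometries W V := ⟨h.right, h.left, h.ortho'⟩
  rw [h.amp_mul_amp, h'.amp_mul_amp]
  abel

lemma isDefect_commutatorDefect (a : A) : IsDefect (commutatorDefect a) where
  nonneg x := (norm_nonneg _).trans (le_max_left _ _)
  add_le x y := by
    refine max_le ?_ ?_
    · rw [show (x + y) * a - a * (x + y) = (x * a - a * x) + (y * a - a * y) by noncomm_ring]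
      exact (norm_add_le _ _).trans (add_le_add (le_max_left _ _) (le_max_left _ _))
    · rw [star_add, show (star x + star y) * a - a * (star x + star y) =
        (star x * a - a * star x) + (star y * a - a * star y) by noncomm_ring]
      exact (norm_add_le _ _).trans (add_le_add (le_max_right _ _) (le_max_right _ _))
  smul_le r x := by
    refine max_le ?_ ?_
    · rw [smul_mul_assoc, mul_smul_comm, ← smul_sub, norm_smul, Real.norm_eq_abs]
      gcongr
      exact le_max_left _ _
    · rw [star_smul, star_trivial, smul_mul_assoc, mul_smul_comm, ← smul_sub, norm_smul,
        Real.norm_eq_abs]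
      gcongr
      exact le_max_right _ _
  one := by simp [commutatorDefect]
  star_eq x := by simp [commutatorDefect, max_comm]
  mul_le x y := by
    refine max_le ?_ ?_
    · rw [show x * y * a - a * (x * y) = x * (y * a - a * y) + (x * a - a * x) * y by
        noncomm_ring]
      refine (norm_add_le _ _).trans (add_le_add ((norm_mul_le _ _).trans ?_)
        ((norm_mul_le _ _).trans ?_)) <;> gcongr <;> exact le_max_left _ _
    · rw [star_mul, show star y * star x * a - a * (star y * star x) =
        (star y * a - a * star y) * star x + star y * (star x * a - a * star x) by noncomm_ring]
      refine (norm_add_le _ _).trans ?_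
      rw [add_comm (‖x‖ * _)]
      rw [add_comm]
      refine add_le_add ((norm_mul_le _ _).trans ?_) ((norm_mul_le _ _).trans ?_)
      · rw [norm_star, mul_comm]; gcongr; exact le_max_right _ _
      · rw [norm_star, mul_comm]; gcongr; exact le_max_right _ _
  bounded := by
    refine ⟨2 * ‖a‖, by positivity, fun x => max_le ?_ ?_⟩
    · refine (norm_sub_le _ _).trans ((add_le_add (norm_mul_le _ _) (norm_mul_le _ _)).trans ?_)
      linarith
    · refine (norm_sub_le _ _).trans ((add_le_add (norm_mul_le _ _) (norm_mul_le _ _)).trans ?_)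
      rw [norm_star]; linarith
  amp_mul_amp_le := by
    intro V W h b c hb hc
    refine max_le ?_ ?_
    · refine (norm_commutator_amp_mul_amp_le a h hb hc).trans ?_
      gcongr <;> exact le_max_left _ _
    · rw [star_mul, star_amp, star_amp, h.amp_comm]
      refine (norm_commutator_amp_mul_amp_le a h (Unitary.star_mem hb)
        (Unitary.star_mem hc)).trans ?_
      gcongr <;> exact le_max_right _ _

lemma commutatorDefect_of_unitary (a : A) {x : A} (hx : x ∈ unitary A) :
    commutatorDefect a x = ‖x * a - a * x‖ := by
  refine max_eq_left ?_
  have e : star x * a - a * star x = -(star x * (x * a - a * x) * star x) := by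
    obtain ⟨h1, h2⟩ := Unitary.mem_iff.mp hx
    have h1' (z : A) : star x * (x * z) = z := by rw [← mul_assoc, h1, one_mul]
    simp only [mul_sub, sub_mul, mul_assoc, h1', h2, mul_one]
    abel
  have h1 := norm_le_one_of_unitary (Unitary.star_mem hx)
  rw [e, norm_neg]
  calc _ ≤ ‖star x‖ * ‖x * a - a * x‖ * ‖star x‖ := norm_mul_three_le _ _ _
    _ ≤ 1 * ‖x * a - a * x‖ * 1 := by gcongr
    _ = _ := by ring

lemma commutatorDefect_le_add (a a' x : A) (hx : ‖x‖ ≤ 1) :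
    commutatorDefect a x ≤ commutatorDefect a' x + 2 * ‖a - a'‖ := by
  have aux : ∀ y : A, ‖y‖ ≤ 1 → ‖y * a - a * y‖ ≤ ‖y * a' - a' * y‖ + 2 * ‖a - a'‖ := by
    intro y hy
    have e : y * a - a * y = (y * a' - a' * y) + (y * (a - a') - (a - a') * y) := by noncomm_ring
    rw [e]
    refine (norm_add_le _ _).trans (add_le_add le_rfl ((norm_sub_le _ _).trans ?_))
    calc _ ≤ 1 * ‖a - a'‖ + ‖a - a'‖ * 1 :=
          add_le_add ((norm_mul_le _ _).trans (by gcongr)) ((norm_mul_le _ _).trans (by gcongr))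
      _ = _ := by ring
  refine max_le ((aux x hx).trans ?_) ((aux (star x) (by rwa [norm_star])).trans ?_)
  · gcongr; exact le_max_left _ _
  · gcongr; exact le_max_right _ _

lemma norm_starAlgEquiv_apply (φ : A ≃⋆ₐ[ℂ] A) (x : A) : ‖φ x‖ = ‖x‖ :=
  NonUnitalStarAlgHom.norm_map φ φ.injective x

lemma isDefect_norm_apply_sub (φ : A ≃⋆ₐ[ℂ] A) : IsDefect fun x => ‖φ x - x‖ where
  nonneg x := norm_nonneg _
  add_le x y := by
    rw [map_add, add_sub_add_comm]
    exact norm_add_le _ _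
  smul_le r x := by
    have e : φ (r • x) = r • φ x := by
      rw [← Complex.coe_smul, ← Complex.coe_smul, map_smul]
    rw [e, ← smul_sub, norm_smul, Real.norm_eq_abs]
  one := by simp
  star_eq x := by rw [map_star, ← star_sub, norm_star]
  mul_le x y := by
    rw [map_mul, show φ x * φ y - x * y = φ x * (φ y - y) + (φ x - x) * y by noncomm_ring]
    refine (norm_add_le _ _).trans (add_le_add ((norm_mul_le _ _).trans ?_) (norm_mul_le _ _))
    rw [norm_starAlgEquiv_apply]
  bounded := by
    refine ⟨2, by norm_num, fun x => (norm_sub_le _ _).trans ?_⟩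
    rw [norm_starAlgEquiv_apply]; linarith
  amp_mul_amp_le := by
    intro V W h b c hb hc
    have aux : ∀ {V b : A}, star V * V = 1 → b ∈ unitary A →
        ‖(φ V - V) * (φ b - 1) * star (φ V) + V * (φ b - 1) * star (φ V - V)‖ ≤
          4 * ‖φ V - V‖ := by
      intro V b hV hb
      have h3 : ‖φ b - 1‖ ≤ 2 := by
        rw [← map_one φ, ← map_sub, norm_starAlgEquiv_apply]; exact norm_sub_one_le_two hb
      have h4 := norm_le_one_of_isometry hV
      have h5 : ‖φ V‖ ≤ 1 := by rwa [norm_starAlgEquiv_apply]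
      calc _ ≤ ‖φ V - V‖ * 2 * 1 + 1 * 2 * ‖φ V - V‖ := by
            refine (norm_add_le _ _).trans (add_le_add ((norm_mul_three_le _ _ _).trans ?_)
              ((norm_mul_three_le _ _ _).trans ?_)) <;> rw [norm_star] <;> gcongr
        _ = _ := by ring
    have e : φ (amp V b * amp W c) - amp V b * amp W c =
        (V * (φ b - b) * star V + W * (φ c - c) * star W) +
        (((φ V - V) * (φ b - 1) * star (φ V) + V * (φ b - 1) * star (φ V - V)) +
        ((φ W - W) * (φ c - 1) * star (φ W) + W * (φ c - 1) * star (φ W - W))) := by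
      rw [h.amp_mul_amp]
      simp only [map_add, map_one, map_mul, map_sub, map_star, star_sub]
      noncomm_ring
    rw [e]
    refine (norm_add_le _ _).trans (add_le_add (h.norm_add_le _ _) ((norm_add_le _ _).trans ?_))
    linarith [aux h.left hb, aux h.right hc]

namespace IsDefect

variable {p : A → ℝ} (hp : IsDefect p)
include hp

lemma neg_le (x : A) : p (-x) ≤ p x := by
  simpa using hp.smul_le (-1) x

lemma sub_le (x y : A) : p (x - y) ≤ p x + p y := by
  rw [sub_eq_add_neg]
  exact (hp.add_le _ _).trans (add_le_add le_rfl (hp.neg_le y))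

lemma mul_le_of_norm_le {x y : A} (hx : ‖x‖ ≤ 1) (hy : ‖y‖ ≤ 1) : p (x * y) ≤ p x + p y := by
  have h1 := hp.nonneg x
  have h2 := hp.nonneg y
  have h := hp.mul_le x y
  nlinarith

lemma sub_one_le (x : A) : p (x - 1) ≤ p x := by
  simpa [hp.one] using hp.sub_le x 1

lemma one_add_le (x : A) : p (1 + x) ≤ p x := by
  simpa [hp.one] using hp.add_le 1 x

lemma amp_le {V b : A} (hV : star V * V = 1) (hb : b ∈ unitary A) :
    p (amp V b) ≤ p b + 4 * p V := by
  have h1 := norm_le_one_of_isometry hV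
  have h2 := norm_sub_one_le_two hb
  have h3 := hp.sub_one_le b
  have h4 := hp.nonneg V
  have h5 := hp.mul_le (V * (b - 1)) (star V)
  have h6 := hp.mul_le V (b - 1)
  have h7 : ‖V * (b - 1)‖ ≤ 1 * 2 := (norm_mul_le _ _).trans (by gcongr)
  have h8 := hp.nonneg (V * (b - 1))
  have h9 := hp.nonneg (b - 1)
  rw [hp.star_eq, norm_star] at h5
  refine (hp.one_add_le _).trans ?_
  have h10 : p (V * (b - 1)) ≤ p b + p V * 2 := by
    refine h6.trans (add_le_add ?_ (by gcongr))
    nlinarith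
  nlinarith

lemma swapGenerator_le {V W : A} (h : OrthoIsometries V W) :
    p (swapGenerator V W) ≤ 2 * (p V + p W) := by
  have h1 := norm_le_one_of_isometry h.left
  have h2 := norm_le_one_of_isometry h.right
  have h3 := hp.mul_le_of_norm_le h2 (by rwa [norm_star] : ‖star V‖ ≤ 1)
  have h4 := hp.mul_le_of_norm_le h1 (by rwa [norm_star] : ‖star W‖ ≤ 1)
  rw [hp.star_eq] at h3 h4
  have := hp.sub_le (W * star V) (V * star W)
  unfold swapGenerator
  linarith

lemma cornerGenerator_le {V : A} (hV : star V * V = 1) : p (cornerGenerator V) ≤ 6 * p V := by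
  have h1 := norm_le_one_of_isometry hV
  have h1' : ‖star V‖ ≤ 1 := by rwa [norm_star]
  have h2 := norm_range_compl_le hV
  have h3 := hp.mul_le_of_norm_le h1 h1'
  have h4 : p (1 - V * star V) ≤ p (V * star V) := by
    simpa [hp.one] using hp.sub_le 1 (V * star V)
  have h5 := hp.mul_le_of_norm_le h1 h2
  have h6 := hp.mul_le_of_norm_le h2 h1'
  have h7 := hp.sub_le (V * (1 - V * star V)) ((1 - V * star V) * star V)
  rw [hp.star_eq] at h3 h6
  unfold cornerGenerator
  linarith

lemma rotation_le {K : A} (hK : IsRotationGenerator K) (θ : ℝ) : p (rotation K θ) ≤ 5 * p K := by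
  have h1 := hK.norm_le_one
  have h2 := hp.mul_le_of_norm_le h1 h1
  have h3 := hp.nonneg K
  have h4 := hp.nonneg (K * K)
  have h5 : p (Real.sin θ • K) ≤ 1 * p K :=
    (hp.smul_le _ _).trans (by gcongr; exact Real.abs_sin_le_one θ)
  have h6 : p ((1 - Real.cos θ) • (K * K)) ≤ 2 * p (K * K) := by
    refine (hp.smul_le _ _).trans ?_
    gcongr
    rw [abs_le]
    constructor <;> linarith [Real.cos_le_one θ, Real.neg_one_le_cos θ]
  refine (hp.one_add_le _).trans ((hp.add_le _ _).trans ?_)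
  linarith

lemma rotPath_le {K b : A} (hK : IsRotationGenerator K) (hb : b ∈ unitary A) (s : ℝ) :
    p (rotPath K b s) ≤ 2 * p b + 10 * p K := by
  have hR := hK.rotation_mem_unitary (s * (Real.pi / 2))
  have h1 := hp.rotation_le hK (s * (Real.pi / 2))
  unfold rotPath
  set R := rotation K (s * (Real.pi / 2))
  have hb' := Unitary.star_mem hb
  have hR' := Unitary.star_mem hR
  have h2 := hp.mul_le_of_norm_le (norm_le_one_of_unitary hb) (norm_le_one_of_unitary hR)
  have h3 := hp.mul_le_of_norm_le (norm_le_one_of_unitary (mul_mem hb hR))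
    (norm_le_one_of_unitary hb')
  have h4 := hp.mul_le_of_norm_le (norm_le_one_of_unitary (mul_mem (mul_mem hb hR) hb'))
    (norm_le_one_of_unitary hR')
  rw [hp.star_eq] at h3 h4
  linarith

lemma swindle_le {S T : A} (h : OrthoIsometries S T) (n : ℕ) {u : ℕ → A}
    (hu : ∀ j, u j ∈ unitary A) {m : ℝ} (hm : 0 ≤ m) (hum : ∀ j, p (u j) ≤ m) :
    p (swindle S T n u) ≤ m + n * (4 * (p S + p T)) := by
  have h1 := hp.nonneg S
  have h2 := hp.nonneg T
  induction n generalizing u with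
  | zero => simpa [swindle, hp.one] using hm
  | succ n ih =>
    have hmem : swindle S T n (fun j => u (j + 1)) ∈ unitary A :=
      (swindle_mem (J := ⊤) h n fun j => ⟨hu (j + 1), trivial⟩).1
    refine (hp.amp_mul_amp_le h (hu 0) hmem).trans ?_
    have h3 : max (p (u 0)) (p (swindle S T n fun j => u (j + 1))) ≤
        m + n * (4 * (p S + p T)) := by
      refine max_le ((hum 0).trans ?_) (ih (fun j => hu (j + 1)) fun j => hum (j + 1))
      have : 0 ≤ (n : ℝ) * (4 * (p S + p T)) := by positivity
      linarith
    push_cast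
    linarith

end IsDefect

/-! ### The short path at a fixed time -/

/-- The path from `1` to `amp S Y * star (amp (S * T) Y)`; the range of `S` is first rotated into the
range of `T` and then into that of `S * T`. -/
noncomputable def swindlePath (S T Y : A) (s : ℝ) : A :=
  rotPath (swapGenerator S T) (amp S Y) s * rotPath (swapGenerator T (S * T)) (amp T Y) s

/-- The path that reaches `u` approximately: the factor `u * star (amp V u)`, `V = S * S`, is
supported on the complement of the range of `V` and is rotated into that range. -/
noncomputable def roughPath (S T u Y : A) (s : ℝ) : A :=
  rotPath (cornerGenerator (S * S)) (u * star (amp (S * S) u)) s *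
    (swindlePath S T Y s * star (amp (S * S) (swindlePath S T Y s)) * swindlePath S T Y s)

/-- The path `roughPath` with its endpoint corrected to `u`. -/
noncomputable def shortPath (S T u Y : A) (s : ℝ) : A :=
  cayleyPath (u * star (roughPath S T u Y 1)) s * roughPath S T u Y s

section
variable {S T : A} (h : OrthoIsometries S T)
include h

lemma OrthoIsometries.sq : star (S * S) * (S * S) = 1 := by
  rw [star_mul, mul_assoc, ← mul_assoc (star S) S, h.left, one_mul, h.left]

lemma swindlePath_mem {J : TwoSidedIdeal A} {Y : A} (hY : Y ∈ idealUnitary J) (s : ℝ) :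
    swindlePath S T Y s ∈ idealUnitary J :=
  mul_mem_idealUnitary
    (rotPath_mem h.isRotationGenerator (amp_mem_idealUnitary h.left hY) s)
    (rotPath_mem h.shift.isRotationGenerator (amp_mem_idealUnitary h.right hY) s)

lemma roughPath_mem {J : TwoSidedIdeal A} {u Y : A} (hu : u ∈ idealUnitary J)
    (hY : Y ∈ idealUnitary J) (s : ℝ) : roughPath S T u Y s ∈ idealUnitary J := by
  have hN := swindlePath_mem h hY s
  exact mul_mem_idealUnitary
    (rotPath_mem (isRotationGenerator_cornerGenerator h.sq)
      (mul_mem_idealUnitary hu (star_mem_idealUnitary (amp_mem_idealUnitary h.sq hu))) s)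
    (mul_mem_idealUnitary (mul_mem_idealUnitary hN
      (star_mem_idealUnitary (amp_mem_idealUnitary h.sq hN))) hN)

omit h in
lemma mem_idealUnitary_top {b : A} (hb : b ∈ unitary A) :
    b ∈ idealUnitary (⊤ : TwoSidedIdeal A) := ⟨hb, trivial⟩

lemma swindlePath_zero {Y : A} (hY : Y ∈ unitary A) : swindlePath S T Y 0 = 1 := by
  rw [swindlePath, rotPath_zero (amp_mem_unitary h.left hY),
    rotPath_zero (amp_mem_unitary h.right hY), one_mul]

lemma roughPath_zero {u Y : A} (hu : u ∈ unitary A) (hY : Y ∈ unitary A) :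
    roughPath S T u Y 0 = 1 := by
  rw [roughPath, swindlePath_zero h hY, rotPath_zero]
  · simp
  · exact mul_mem hu (Unitary.star_mem (amp_mem_unitary h.sq hu))

lemma swindlePath_one {Y : A} (hY : Y ∈ unitary A) :
    swindlePath S T Y 1 = amp S Y * star (amp (S * T) Y) := by
  have hT := (Unitary.mem_iff.mp (amp_mem_unitary h.right hY)).1
  rw [swindlePath, h.rotPath_one, h.shift.rotPath_one, mul_assoc, ← mul_assoc (star (amp T Y)), hT,
    one_mul]

lemma norm_swindlePath_one_sub_le {u Y : A} (hY : Y ∈ unitary A) {ε : ℝ}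
    (hYε : ‖Y - amp S u * amp T Y‖ ≤ ε) : ‖swindlePath S T Y 1 - amp (S * S) u‖ ≤ ε := by
  have hST : star (S * T) * (S * T) = 1 := h.shift.right
  have hU := amp_mem_unitary hST hY
  have e : amp (S * S) u = amp S (amp S u * amp T Y) * star (amp (S * T) Y) := by
    rw [amp_mul h.left, amp_amp, amp_amp, mul_assoc, (Unitary.mem_iff.mp hU).2, mul_one]
  rw [swindlePath_one h hY, e, ← sub_mul]
  calc _ ≤ ‖amp S Y - amp S (amp S u * amp T Y)‖ * ‖star (amp (S * T) Y)‖ := norm_mul_le _ _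
    _ ≤ ε * 1 := by
      have := (norm_nonneg _).trans hYε
      gcongr
      · exact (norm_amp_sub_le h.left _ _).trans hYε
      · exact norm_le_one_of_unitary (Unitary.star_mem hU)
    _ = ε := mul_one ε

lemma norm_commutator_sq_le {u : A} {ε : ℝ} (huε : ‖u * S - S * u‖ ≤ ε) :
    ‖u * (S * S) - (S * S) * u‖ ≤ 2 * ε := by
  have h1 := norm_le_one_of_isometry h.left
  have e : u * (S * S) - (S * S) * u = (u * S - S * u) * S + S * (u * S - S * u) := by
    noncomm_ring
  have := (norm_nonneg _).trans huε
  rw [e]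
  calc _ ≤ ε * 1 + 1 * ε := (norm_add_le _ _).trans (add_le_add
        ((norm_mul_le _ _).trans (by gcongr)) ((norm_mul_le _ _).trans (by gcongr)))
    _ = _ := by ring

lemma norm_roughPath_one_sub_le {u Y : A} (hu : u ∈ unitary A) (hY : Y ∈ unitary A) {ε : ℝ}
    (huε : ‖u * S - S * u‖ ≤ ε) (hYε : ‖Y - amp S u * amp T Y‖ ≤ ε) :
    ‖roughPath S T u Y 1 - u‖ ≤ 11 * ε := by
  have hN := (swindlePath_mem h (mem_idealUnitary_top hY) 1).1
  have hNε := norm_swindlePath_one_sub_le h hY hYε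
  have hV := h.sq
  have hη := norm_commutator_sq_le h huε
  unfold roughPath
  rw [rotPath_one]
  set N := swindlePath S T Y 1
  set V := S * S
  have hvu := amp_mem_unitary hV hu
  have hw : u * star (amp V u) ∈ unitary A := mul_mem hu (Unitary.star_mem hvu)
  have h1 := norm_corner_conj_sub_amp_le hV hw
    ((norm_mul_star_amp_mul_sub_le hV hu).trans hη)
  have hR := (isRotationGenerator_cornerGenerator hV).rotation_mem_unitary (Real.pi / 2)
  set R := rotation (cornerGenerator V) (Real.pi / 2)
  set w := u * star (amp V u) with hwdef
  have hampN := amp_mem_unitary hV hN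
  have hampvu := amp_mem_unitary hV hvu
  have hRw : R * w * star R ∈ unitary A := mul_mem (mul_mem hR hw) (Unitary.star_mem hR)
  -- replacing each factor by its approximation leaves exactly `u`
  have e : u = w * star (amp V w) * (amp V u * star (amp V (amp V u)) * amp V u) := by
    have h2 := (Unitary.mem_iff.mp hvu).1
    have h3 := (Unitary.mem_iff.mp hampvu).2
    have h4 := (Unitary.mem_iff.mp hvu).2
    have h5 : star (amp V w) = amp V (amp V u) * star (amp V u) := by
      rw [hwdef, amp_mul hV, star_mul, ← star_amp, star_star]
    calc u = u * star (amp V u) * (amp V (amp V u) * (star (amp V u) * amp V u) *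
          star (amp V (amp V u))) * amp V u := by
            rw [h2, mul_one, h3, mul_one, mul_assoc, h2, mul_one]
      _ = _ := by rw [h5, hwdef]; noncomm_ring
  have key : ∀ {b c b' c' : A}, b ∈ unitary A → c ∈ unitary A → b' ∈ unitary A → c' ∈ unitary A →
      ‖b * c - b' * c'‖ ≤ ‖b - b'‖ + ‖c - c'‖ := fun _ hc hb' _ =>
    norm_mul_sub_mul_le (norm_le_one_of_unitary hc) (norm_le_one_of_unitary hb')
  have hs : ∀ {b}, b ∈ unitary A → star b ∈ unitary A := fun hb => Unitary.star_mem hb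
  have hampw := amp_mem_unitary hV hw
  calc _ = ‖w * star (R * w * star R) * (N * star (amp V N) * N) -
        w * star (amp V w) * (amp V u * star (amp V (amp V u)) * amp V u)‖ := by rw [← e]
    _ ≤ ‖w * star (R * w * star R) - w * star (amp V w)‖ + ‖N * star (amp V N) * N -
        amp V u * star (amp V (amp V u)) * amp V u‖ :=
      key (mul_mem hw (hs hRw)) (mul_mem (mul_mem hN (hs hampN)) hN) (mul_mem hw (hs hampw))
        (mul_mem (mul_mem hvu (hs hampvu)) hvu)
    _ ≤ (‖w - w‖ + ‖star (R * w * star R) - star (amp V w)‖) +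
        ((‖N - amp V u‖ + ‖star (amp V N) - star (amp V (amp V u))‖) + ‖N - amp V u‖) := by
      gcongr
      · exact key hw (hs hRw) hw (hs hampw)
      · refine (key (mul_mem hN (hs hampN)) hN (mul_mem hvu (hs hampvu)) hvu).trans ?_
        gcongr
        exact key hN (hs hampN) hvu (hs hampvu)
    _ ≤ (0 + 4 * (2 * ε)) + ((ε + ε) + ε) := by
      rw [← star_sub, ← star_sub, norm_star, norm_star, sub_self, norm_zero]
      gcongr
      exact (norm_amp_sub_le hV _ _).trans hNε
    _ = _ := by ring

/-- The endpoint correction is small. -/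
lemma norm_correction_sub_one_le {u Y : A} (hu : u ∈ unitary A) (hY : Y ∈ unitary A) {ε : ℝ}
    (huε : ‖u * S - S * u‖ ≤ ε) (hYε : ‖Y - amp S u * amp T Y‖ ≤ ε) :
    ‖u * star (roughPath S T u Y 1) - 1‖ ≤ 11 * ε := by
  have hP := (roughPath_mem h (mem_idealUnitary_top hu) (mem_idealUnitary_top hY) 1).1
  have h1 := norm_roughPath_one_sub_le h hu hY huε hYε
  set P := roughPath S T u Y 1
  have e : u * star P - 1 = -((P - u) * star P) := by
    rw [sub_mul, (Unitary.mem_iff.mp hP).2]; abel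
  rw [e, norm_neg]
  calc _ ≤ ‖P - u‖ * ‖star P‖ := norm_mul_le _ _
    _ ≤ ‖P - u‖ * 1 := by gcongr; exact norm_le_one_of_unitary (Unitary.star_mem hP)
    _ ≤ _ := by linarith

section Static

variable {u Y : A} {ε : ℝ} (hε : 11 * ε ≤ 1) (huε : ‖u * S - S * u‖ ≤ ε)
  (hYε : ‖Y - amp S u * amp T Y‖ ≤ ε)
include hε huε hYε

lemma shortPath_mem {J : TwoSidedIdeal A} (hu : u ∈ idealUnitary J) (hY : Y ∈ idealUnitary J)
    {s : ℝ} (hs : s ∈ Set.Icc (0 : ℝ) 1) : shortPath S T u Y s ∈ idealUnitary J :=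
  mul_mem_idealUnitary
    (cayleyPath_mem hε (norm_correction_sub_one_le h hu.1 hY.1 huε hYε)
      (mul_mem_idealUnitary hu (star_mem_idealUnitary (roughPath_mem h hu hY 1))) hs)
    (roughPath_mem h hu hY s)

omit hε huε hYε in
lemma shortPath_zero (hu : u ∈ unitary A) (hY : Y ∈ unitary A) : shortPath S T u Y 0 = 1 := by
  rw [shortPath, cayleyPath_zero, roughPath_zero h hu hY, one_mul]

omit hε huε hYε in
lemma shortPath_one (hu : u ∈ unitary A) (hY : Y ∈ unitary A) : shortPath S T u Y 1 = u := by
  have hP := (roughPath_mem h (mem_idealUnitary_top hu) (mem_idealUnitary_top hY) 1).1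
  rw [shortPath, cayleyPath_one, mul_assoc, (Unitary.mem_iff.mp hP).1, mul_one]

omit hε huε hYε in
lemma norm_swindlePath_sub_le (hY : Y ∈ unitary A) (s s' : ℝ) :
    ‖swindlePath S T Y s - swindlePath S T Y s'‖ ≤ 4 * Real.pi * |s - s'| := by
  have hY' := mem_idealUnitary_top hY
  have h1 := amp_mem_unitary h.left hY
  have h2 := amp_mem_unitary h.right hY
  refine (norm_mul_sub_mul_le (norm_le_one_of_unitary
      (rotPath_mem h.shift.isRotationGenerator (mem_idealUnitary_top h2) s).1)
    (norm_le_one_of_unitary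
      (rotPath_mem h.isRotationGenerator (mem_idealUnitary_top h1) s').1)).trans ?_
  have h3 := norm_rotPath_sub_le h.isRotationGenerator h1 s s'
  have h4 := norm_rotPath_sub_le h.shift.isRotationGenerator h2 s s'
  linarith

omit hε huε hYε in
lemma norm_roughPath_sub_le (hu : u ∈ unitary A) (hY : Y ∈ unitary A) (s s' : ℝ) :
    ‖roughPath S T u Y s - roughPath S T u Y s'‖ ≤ 14 * Real.pi * |s - s'| := by
  have hN : ∀ r, swindlePath S T Y r ∈ unitary A := fun r =>
    (swindlePath_mem h (mem_idealUnitary_top hY) r).1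
  have hNs : ∀ r, star (amp (S * S) (swindlePath S T Y r)) ∈ unitary A := fun r =>
    Unitary.star_mem (amp_mem_unitary h.sq (hN r))
  have hw : u * star (amp (S * S) u) ∈ unitary A :=
    mul_mem hu (Unitary.star_mem (amp_mem_unitary h.sq hu))
  have hK := isRotationGenerator_cornerGenerator h.sq
  have h1 := norm_swindlePath_sub_le h hY s s'
  have h2 := norm_rotPath_sub_le hK hw s s'
  have h3 : ‖star (amp (S * S) (swindlePath S T Y s)) - star (amp (S * S) (swindlePath S T Y s'))‖
      ≤ 4 * Real.pi * |s - s'| := by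
    rw [← star_sub, norm_star]
    exact (norm_amp_sub_le h.sq _ _).trans h1
  have h4 := norm_mul_sub_mul_le (b := swindlePath S T Y s) (norm_le_one_of_unitary (hNs s))
    (norm_le_one_of_unitary (hN s')) (c' := star (amp (S * S) (swindlePath S T Y s')))
  have h5 := norm_mul_sub_mul_le
    (b := swindlePath S T Y s * star (amp (S * S) (swindlePath S T Y s)))
    (norm_le_one_of_unitary (hN s))
    (norm_le_one_of_unitary (mul_mem (hN s') (hNs s'))) (c' := swindlePath S T Y s')
  have h6 := norm_mul_sub_mul_le
    (b := rotPath (cornerGenerator (S * S)) (u * star (amp (S * S) u)) s)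
    (norm_le_one_of_unitary (mul_mem (mul_mem (hN s) (hNs s)) (hN s)))
    (norm_le_one_of_unitary (rotPath_mem hK (mem_idealUnitary_top hw) s').1)
    (c' := swindlePath S T Y s' * star (amp (S * S) (swindlePath S T Y s')) *
      swindlePath S T Y s')
  unfold roughPath
  linarith

lemma norm_shortPath_sub_le (hu : u ∈ unitary A) (hY : Y ∈ unitary A) {s s' : ℝ}
    (hs : s ∈ Set.Icc (0 : ℝ) 1) (hs' : s' ∈ Set.Icc (0 : ℝ) 1) :
    ‖shortPath S T u Y s - shortPath S T u Y s'‖ ≤ (14 * Real.pi + 4) * |s - s'| := by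
  have hz := norm_correction_sub_one_le h hu hY huε hYε
  have hP := fun r => roughPath_mem h (mem_idealUnitary_top hu) (mem_idealUnitary_top hY) r
  have hc := (cayleyPath_mem hε hz (mul_mem_idealUnitary (mem_idealUnitary_top hu)
    (star_mem_idealUnitary (hP 1))) hs').1
  refine (norm_mul_sub_mul_le (norm_le_one_of_unitary (hP s).1)
    (norm_le_one_of_unitary hc)).trans ?_
  have h1 := norm_roughPath_sub_le h hu hY s s'
  have h2 := norm_cayleyPath_sub_le hε hz hs hs'
  linarith

end Static

/-- The defect of the short path is controlled by those of `u`, of the swindle `Y`, and of the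
isometries, up to the defect of the endpoint correction. -/
lemma IsDefect.shortPath_le {p : A → ℝ} (hp : IsDefect p) {C : ℝ} (hC0 : 0 ≤ C)
    (hC : ∀ x, p x ≤ C * ‖x‖) {u Y : A} {ε : ℝ}
    (hε : 11 * ε ≤ 1) (huε : ‖u * S - S * u‖ ≤ ε) (hYε : ‖Y - amp S u * amp T Y‖ ≤ ε)
    (hu : u ∈ unitary A) (hY : Y ∈ unitary A) {s : ℝ} (hs : s ∈ Set.Icc (0 : ℝ) 1) :
    p (shortPath S T u Y s) ≤ 4 * p u + 12 * p Y + 400 * (p S + p T) + C * (22 * ε) := by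
  have hS := hp.nonneg S
  have hT := hp.nonneg T
  have hS1 := norm_le_one_of_isometry h.left
  have hT1 := norm_le_one_of_isometry h.right
  have hSS := hp.mul_le_of_norm_le hS1 hS1
  have hST := hp.mul_le_of_norm_le hS1 hT1
  have hz := norm_correction_sub_one_le h hu hY huε hYε
  have hP := fun r => roughPath_mem h (mem_idealUnitary_top hu) (mem_idealUnitary_top hY) r
  have hc := (cayleyPath_mem hε hz (mul_mem_idealUnitary (mem_idealUnitary_top hu)
    (star_mem_idealUnitary (hP 1))) hs).1
  have hcp : p (cayleyPath (u * star (roughPath S T u Y 1)) s) ≤ C * (22 * ε) := by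
    have h1 : p (cayleyPath (u * star (roughPath S T u Y 1)) s) ≤
        p (cayleyPath (u * star (roughPath S T u Y 1)) s - 1) := by
      simpa using hp.one_add_le (cayleyPath (u * star (roughPath S T u Y 1)) s - 1)
    refine h1.trans ((hC _).trans ?_)
    gcongr
    have := norm_cayleyPath_sub_one_le hε hz hs
    linarith
  have hN : swindlePath S T Y s ∈ unitary A := (swindlePath_mem h (mem_idealUnitary_top hY) s).1
  have hNp : p (swindlePath S T Y s) ≤ 4 * p Y + 68 * (p S + p T) := by
    have hr1 := (rotPath_mem h.isRotationGenerator
      (mem_idealUnitary_top (amp_mem_unitary h.left hY)) s).1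
    have hr2 := (rotPath_mem h.shift.isRotationGenerator
      (mem_idealUnitary_top (amp_mem_unitary h.right hY)) s).1
    have h1 := hp.mul_le_of_norm_le (norm_le_one_of_unitary hr1) (norm_le_one_of_unitary hr2)
    have h2 := hp.rotPath_le h.isRotationGenerator (amp_mem_unitary h.left hY) s
    have h3 := hp.rotPath_le h.shift.isRotationGenerator (amp_mem_unitary h.right hY) s
    have h4 := hp.amp_le h.left hY
    have h5 := hp.amp_le h.right hY
    have h6 := hp.swapGenerator_le h
    have h7 := hp.swapGenerator_le h.shift
    unfold swindlePath
    linarith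
  have hNs := amp_mem_unitary h.sq hN
  have hw : u * star (amp (S * S) u) ∈ unitary A :=
    mul_mem hu (Unitary.star_mem (amp_mem_unitary h.sq hu))
  have hK := isRotationGenerator_cornerGenerator h.sq
  have hPp : p (roughPath S T u Y s) ≤ 4 * p u + 12 * p Y + 400 * (p S + p T) := by
    have h1 := hp.amp_le h.sq hN
    have h2 := hp.mul_le_of_norm_le (norm_le_one_of_unitary hN)
      (norm_le_one_of_unitary (Unitary.star_mem hNs))
    have h3 := hp.mul_le_of_norm_le
      (norm_le_one_of_unitary (mul_mem hN (Unitary.star_mem hNs))) (norm_le_one_of_unitary hN)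
    have h4 := hp.mul_le_of_norm_le
      (norm_le_one_of_unitary (rotPath_mem hK (mem_idealUnitary_top hw) s).1)
      (norm_le_one_of_unitary (mul_mem (mul_mem hN (Unitary.star_mem hNs)) hN))
    have h5 := hp.rotPath_le hK hw s
    have h6 := hp.mul_le_of_norm_le (norm_le_one_of_unitary hu)
      (norm_le_one_of_unitary (Unitary.star_mem (amp_mem_unitary h.sq hu)))
    have h7 := hp.amp_le h.sq hu
    have h8 := hp.cornerGenerator_le h.sq
    rw [hp.star_eq] at h2 h6
    unfold roughPath
    linarith
  have h1 := hp.mul_le_of_norm_le (norm_le_one_of_unitary hc) (norm_le_one_of_unitary (hP s).1)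
  unfold shortPath
  linarith

end

lemma continuous_roughPath {X : Type*} [TopologicalSpace X] {S T u Y : X → A} {s : X → ℝ}
    (hS : Continuous S) (hT : Continuous T) (hu : Continuous u) (hY : Continuous Y)
    (hs : Continuous s) : Continuous fun t => roughPath (S t) (T t) (u t) (Y t) (s t) := by
  have hN : Continuous fun t => swindlePath (S t) (T t) (Y t) (s t) := by
    unfold swindlePath swapGenerator
    exact (continuous_rotPath (by fun_prop) (continuous_amp hS hY) hs).mul
      (continuous_rotPath (by fun_prop) (continuous_amp hT hY) hs)
  unfold roughPath
  refine (continuous_rotPath ?_ (hu.mul (continuous_amp (hS.mul hS) hu).star) hs).mul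
    ((hN.mul (continuous_amp (hS.mul hS) hN).star).mul hN)
  unfold cornerGenerator
  fun_prop

/-! ### Lifting the Cuntz isometries -/

lemma tendsto_add_const_nnreal (r : ℝ≥0) : Tendsto (fun t : ℝ≥0 => t + r) atTop atTop :=
  tendsto_atTop_mono (fun _ => le_self_add) tendsto_id

/-- An asymptotic isometry is asymptotic to a path of isometries, by polar decomposition. -/
lemma exists_isometry_path {f : ℝ≥0 → A} (hf : Continuous f)
    (h : Tendsto (fun t => star (f t) * f t) atTop (𝓝 1)) :
    ∃ (r : ℝ≥0) (S B : ℝ≥0 → A), Continuous S ∧ (∀ t, star (S t) * S t = 1) ∧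
      Tendsto (fun t => S t - f (t + r)) atTop (𝓝 0) ∧ ∀ t, S t = f (t + r) * B t := by
  let _ : PartialOrder A := CStarAlgebra.spectralOrder A
  have _ : StarOrderedRing A := CStarAlgebra.spectralOrderedRing A
  have hc : Continuous fun t => CFC.abs (f t) := by
    unfold CFC.abs
    exact CFC.continuousOn_sqrt.comp_continuous (by fun_prop) fun t => star_mul_self_nonneg (f t)
  have hlim : Tendsto (fun t => CFC.abs (f t)) atTop (𝓝 1) := by
    have h1 := CFC.continuousOn_sqrt (A := A) 1 (zero_le_one' A)
    rw [ContinuousWithinAt, CFC.sqrt_one] at h1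
    exact h1.comp (tendsto_nhdsWithin_iff.mpr
      ⟨h, Eventually.of_forall fun t => star_mul_self_nonneg (f t)⟩)
  obtain ⟨r, hr⟩ := eventually_atTop.mp
    (hlim.eventually (Metric.ball_mem_nhds (1 : A) one_pos))
  have hunit : ∀ t, IsUnit (CFC.abs (f (t + r))) := by
    intro t
    have h1 := hr (t + r) le_add_self
    rw [dist_eq_norm, ← norm_neg, neg_sub] at h1
    simpa using isUnit_one_sub_of_norm_lt_one h1
  have hiso : ∀ t, star (f (t + r) * Ring.inverse (CFC.abs (f (t + r)))) *
      (f (t + r) * Ring.inverse (CFC.abs (f (t + r)))) = 1 := by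
    intro t
    have h1 := Ring.mul_inverse_cancel _ (hunit t)
    have h2 := CFC.abs_mul_abs (f (t + r))
    have h3 : star (CFC.abs (f (t + r))) = CFC.abs (f (t + r)) :=
      (IsSelfAdjoint.of_nonneg (CFC.abs_nonneg _)).star_eq
    set c := CFC.abs (f (t + r))
    calc _ = star (Ring.inverse c) * (star (f (t + r)) * f (t + r)) * Ring.inverse c := by
          rw [star_mul]; noncomm_ring
      _ = star (c * Ring.inverse c) * (c * Ring.inverse c) := by
          rw [← h2, star_mul, h3]; noncomm_ring
      _ = 1 := by rw [h1]; simp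
  refine ⟨r, fun t => f (t + r) * Ring.inverse (CFC.abs (f (t + r))),
    fun t => Ring.inverse (CFC.abs (f (t + r))), ?_, hiso, ?_, fun t => rfl⟩
  · have h1 : Continuous fun t => Ring.inverse (CFC.abs (f (t + r))) := by
      refine continuous_iff_continuousAt.mpr fun t => ?_
      obtain ⟨v, hv⟩ := hunit t
      have h1 : ContinuousAt (fun t => CFC.abs (f (t + r))) t :=
        (hc.comp (by fun_prop : Continuous fun t : ℝ≥0 => t + r)).continuousAt
      refine ContinuousAt.comp (g := Ring.inverse) ?_ h1
      rw [← hv]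
      exact NormedRing.inverse_continuousAt v
    fun_prop
  · have h1 : Tendsto (fun t => ‖CFC.abs (f (t + r)) - 1‖) atTop (𝓝 0) := by
      rw [← tendsto_iff_norm_sub_tendsto_zero]
      exact hlim.comp (tendsto_add_const_nnreal r)
    refine squeeze_zero_norm (fun t => ?_) h1
    have h2 := Ring.inverse_mul_cancel _ (hunit t)
    have h3 := norm_le_one_of_isometry (hiso t)
    have e : f (t + r) * Ring.inverse (CFC.abs (f (t + r))) - f (t + r) =
        -(f (t + r) * Ring.inverse (CFC.abs (f (t + r))) * (CFC.abs (f (t + r)) - 1)) := by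
      rw [mul_sub, mul_assoc, h2]; noncomm_ring
    rw [e, norm_neg]
    calc _ ≤ _ := norm_mul_le _ _
      _ ≤ 1 * ‖CFC.abs (f (t + r)) - 1‖ := by gcongr
      _ = _ := one_mul _

/-- Asymptotic isometries with asymptotically orthogonal ranges are asymptotic to paths of isometries
with orthogonal ranges. -/
lemma exists_orthoIsometries_path {f g : ℝ≥0 → A} (hf : Continuous f) (hg : Continuous g)
    (hff : Tendsto (fun t => star (f t) * f t) atTop (𝓝 1))
    (hgg : Tendsto (fun t => star (g t) * g t) atTop (𝓝 1))
    (hfg : Tendsto (fun t => star (f t) * g t) atTop (𝓝 0)) (hgb : ∃ C, ∀ t, ‖g t‖ ≤ C) :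
    ∃ (r : ℝ≥0) (S T : ℝ≥0 → A), Continuous S ∧ Continuous T ∧
      (∀ t, OrthoIsometries (S t) (T t)) ∧
      Tendsto (fun t => S t - f (t + r)) atTop (𝓝 0) ∧
      Tendsto (fun t => T t - g (t + r)) atTop (𝓝 0) := by
  obtain ⟨C, hC⟩ := hgb
  obtain ⟨r, S, -, hS, hSi, hSf, -⟩ := exists_isometry_path hf hff
  have hshift := tendsto_add_const_nnreal r
  have hSg : Tendsto (fun t => star (S t) * g (t + r)) atTop (𝓝 0) := by
    have h1 : Tendsto (fun t => star (S t - f (t + r)) * g (t + r)) atTop (𝓝 0) := by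
      refine squeeze_zero_norm (a := fun t => ‖S t - f (t + r)‖ * C) (fun t => ?_) ?_
      · refine (norm_mul_le _ _).trans ?_
        rw [norm_star]
        gcongr
        exact hC _
      · simpa using (tendsto_norm_zero.comp hSf).mul_const C
    have h2 := h1.add (hfg.comp hshift)
    rw [add_zero] at h2
    refine h2.congr fun t => ?_
    simp only [Function.comp, star_sub]
    noncomm_ring
  have hk : Continuous fun t => (1 - S t * star (S t)) * g (t + r) := by fun_prop
  have hkk : Tendsto (fun t => star ((1 - S t * star (S t)) * g (t + r)) *
      ((1 - S t * star (S t)) * g (t + r))) atTop (𝓝 1) := by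
    have h1 := (hgg.comp hshift).sub (hSg.star.mul hSg)
    rw [star_zero, zero_mul, sub_zero] at h1
    refine h1.congr fun t => ?_
    have h2 := range_compl_mul_self (hSi t)
    have h3 : star (1 - S t * star (S t)) = 1 - S t * star (S t) := by simp
    symm
    calc _ = star (g (t + r)) * ((1 - S t * star (S t)) * (1 - S t * star (S t))) * g (t + r) := by
          rw [star_mul, h3]; simp only [mul_assoc]
      _ = _ := by
          rw [h2]
          simp only [Function.comp, star_mul, star_star]
          noncomm_ring
  obtain ⟨r', T, B, hT, hTi, hTk, hTB⟩ := exists_isometry_path hk hkk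
  have hshift' := tendsto_add_const_nnreal r'
  refine ⟨r' + r, fun t => S (t + r'), T, by fun_prop, hT, fun t => ⟨hSi _, hTi t, ?_⟩, ?_, ?_⟩
  · rw [hTB t, ← mul_assoc, ← mul_assoc, star_mul_range_compl (hSi _), zero_mul, zero_mul]
  · refine (hSf.comp hshift').congr fun t => ?_
    simp only [Function.comp, add_assoc]
  · have h1 : Tendsto (fun t => S t * (star (S t) * g (t + r))) atTop (𝓝 0) := by
      refine squeeze_zero_norm (fun t => ?_) (tendsto_norm_zero.comp hSg)
      refine (norm_mul_le _ _).trans ?_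
      have := norm_le_one_of_isometry (hSi t)
      calc _ ≤ 1 * ‖star (S t) * g (t + r)‖ := by gcongr
        _ = _ := one_mul _
    have h2 := hTk.sub (h1.comp hshift')
    rw [sub_zero] at h2
    refine h2.congr fun t => ?_
    simp only [Function.comp, add_assoc]
    noncomm_ring

lemma toFlat_eq_toFlat {f g : Cb A} (h : toFlat A f = toFlat A g) :
    Tendsto (fun t => f t - g t) atTop (𝓝 0) :=
  (Ideal.Quotient.eq (I := czero A)).mp h

lemma tendsto_commutatorDefect {S : ℝ≥0 → A}
    (h : ∀ a, Tendsto (fun t => S t * a - a * S t) atTop (𝓝 0)) (a : A) :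
    Tendsto (fun t => commutatorDefect a (S t)) atTop (𝓝 0) := by
  have h1 := (h a).norm
  have h2 := (h (star a)).norm
  rw [norm_zero] at h1 h2
  have h3 := h1.max h2
  rw [max_self] at h3
  refine h3.congr fun t => ?_
  rw [commutatorDefect]
  congr 1
  rw [← norm_star, ← norm_neg]
  congr 1
  simp

/-- Two asymptotically central, asymptotically fixed paths of isometries with orthogonal ranges. -/
theorem exists_central_isometries {G : Type*} [Group G] (c : CocycleAction G A)
    (ι : cuntzInfinity →⋆ₐ[ℂ] c.fixedFlat) :
    ∃ S T : ℝ≥0 → A, Continuous S ∧ Continuous T ∧ (∀ t, OrthoIsometries (S t) (T t)) ∧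
      (∀ a, Tendsto (fun t => commutatorDefect a (S t)) atTop (𝓝 0)) ∧
      (∀ a, Tendsto (fun t => commutatorDefect a (T t)) atTop (𝓝 0)) ∧
      (∀ g, Tendsto (fun t => ‖c.α g (S t) - S t‖) atTop (𝓝 0)) ∧
      (∀ g, Tendsto (fun t => ‖c.α g (T t) - T t‖) atTop (𝓝 0)) := by
  have hlift : ∀ i, ∃ f : Cb A, toFlat A f = (ι (cuntzGenerator i) : Flat A) := fun i =>
    Ideal.Quotient.mkₐ_surjective ℂ (czero A) _
  choose f hf using hlift
  have hrel : ∀ i j, toFlat A (star (f i) * f j) = if i = j then 1 else 0 := by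
    intro i j
    have h1 : star (ι (cuntzGenerator i)) * ι (cuntzGenerator j) = if i = j then 1 else 0 := by
      rw [← map_star, ← map_mul, star_cuntzGenerator_mul]
      split_ifs <;> simp
    have h2 := congrArg (Subtype.val) h1
    rw [map_mul, ← star_toFlat, hf, hf]
    refine Eq.trans ?_ (h2.trans ?_)
    · rfl
    · split_ifs <;> rfl
  have hiso : ∀ i, Tendsto (fun t => star (f i t) * f i t) atTop (𝓝 1) := by
    intro i
    have h1 : toFlat A (star (f i) * f i) = toFlat A 1 := by rw [hrel, map_one]; simp
    have h2 := (toFlat_eq_toFlat h1).add_const (1 : A)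
    rw [zero_add] at h2
    refine h2.congr fun t => ?_
    simp
  have horth : Tendsto (fun t => star (f 0 t) * f 1 t) atTop (𝓝 0) := by
    have h1 : toFlat A (star (f 0) * f 1) = toFlat A 0 := by rw [hrel, map_zero]; simp
    refine (toFlat_eq_toFlat h1).congr fun t => ?_
    simp
  have hfix : ∀ i, (toFlat A (f i)) ∈ flatCentralizer A ∧
      ∀ g, flatMap (c.α g) (toFlat A (f i)) = toFlat A (f i) := by
    intro i
    rw [← c.mem_fixedFlat, hf]
    exact (ι (cuntzGenerator i)).2
  have hcomm : ∀ i a, Tendsto (fun t => f i t * a - a * f i t) atTop (𝓝 0) := by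
    intro i a
    have h1 := (hfix i).1
    rw [flatCentralizer, StarSubalgebra.mem_centralizer_iff] at h1
    have h2 := (h1 _ ⟨a, rfl⟩).1
    rw [← map_mul, ← map_mul] at h2
    exact toFlat_eq_toFlat h2.symm
  have hinv : ∀ i g, Tendsto (fun t => c.α g (f i t) - f i t) atTop (𝓝 0) := by
    intro i g
    have h1 := (hfix i).2 g
    rw [flatMap_toFlat] at h1
    exact toFlat_eq_toFlat h1
  obtain ⟨r, S, T, hS, hT, hST, hSf, hTf⟩ := exists_orthoIsometries_path (f 0).continuous
    (f 1).continuous (hiso 0) (hiso 1) horth ⟨‖f 1‖, (f 1).norm_coe_le_norm⟩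
  have hshift := tendsto_add_const_nnreal r
  have hcomm' : ∀ {i} {S : ℝ≥0 → A}, Tendsto (fun t => S t - f i (t + r)) atTop (𝓝 0) →
      ∀ a, Tendsto (fun t => S t * a - a * S t) atTop (𝓝 0) := by
    intro i S hS a
    have h1 := ((hS.mul_const a).sub (hS.const_mul a)).add ((hcomm i a).comp hshift)
    rw [zero_mul, mul_zero, sub_zero, add_zero] at h1
    refine h1.congr fun t => ?_
    simp only [Function.comp]
    noncomm_ring
  have hinv' : ∀ {i} {S : ℝ≥0 → A}, Tendsto (fun t => S t - f i (t + r)) atTop (𝓝 0) →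
      ∀ g, Tendsto (fun t => ‖c.α g (S t) - S t‖) atTop (𝓝 0) := by
    intro i S hS g
    have hc := (NonUnitalStarAlgHom.isometry (c.α g) (c.α g).injective).continuous.tendsto 0
    rw [map_zero] at hc
    have h1 := (((hc.comp hS).sub hS).add ((hinv i g).comp hshift)).norm
    rw [sub_zero, add_zero, norm_zero] at h1
    refine h1.congr fun t => ?_
    simp only [Function.comp, map_sub]
    congr 1
    abel
  exact ⟨S, T, hS, hT, hST, tendsto_commutatorDefect (hcomm' hSf),
    tendsto_commutatorDefect (hcomm' hTf), hinv' hSf, hinv' hTf⟩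

/-! ### Choosing the mesh and the reparametrisation -/

/-- The tolerance at time `t`: small enough for the endpoint correction, and vanishing at infinity. -/
noncomputable def tolerance (t : ℝ≥0) : ℝ := 1 / (11 * (1 + (t : ℝ)))

lemma tolerance_pos (t : ℝ≥0) : 0 < tolerance t := by
  unfold tolerance; positivity

lemma tolerance_le (t : ℝ≥0) : 11 * tolerance t ≤ 1 := by
  unfold tolerance
  rw [mul_one_div, div_le_one (by positivity)]
  linarith [t.2]

lemma continuous_tolerance : Continuous tolerance := by
  unfold tolerance
  refine continuous_const.div (by fun_prop) fun t => by positivity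

lemma tendsto_tolerance : Tendsto tolerance atTop (𝓝 0) := by
  unfold tolerance
  refine Tendsto.div_atTop tendsto_const_nhds ?_
  refine Tendsto.const_mul_atTop (by norm_num) ?_
  exact tendsto_atTop_add_const_left _ _ (NNReal.tendsto_coe_atTop.mpr tendsto_id)

/-- A continuous modulus of continuity in the first variable, valid uniformly at each time. -/
lemma exists_mesh {u : unitInterval × ℝ≥0 → A} (hu : Continuous u) :
    ∃ δ : C(ℝ≥0, ℝ), ∀ t, 0 < δ t ∧
      ∀ s s' : unitInterval, |(s : ℝ) - s'| ≤ δ t → ‖u (s, t) - u (s', t)‖ ≤ tolerance t := by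
  refine exists_continuous_forall_mem_convex_of_local_const (t := fun t => {d : ℝ | 0 < d ∧
      ∀ s s' : unitInterval, |(s : ℝ) - s'| ≤ d → ‖u (s, t) - u (s', t)‖ ≤ tolerance t})
    (fun t => ?_) (fun t₀ => ?_)
  · refine Set.OrdConnected.convex ⟨fun d hd d' hd' e he => ⟨hd.1.trans_le he.1, ?_⟩⟩
    exact fun s s' hs => hd'.2 s s' (hs.trans he.2)
  · let F : C(ℝ≥0, C(unitInterval, A)) :=
      ContinuousMap.curry ⟨fun q => u (q.2, q.1), by fun_prop⟩
    have hε := tolerance_pos t₀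
    have huc := CompactSpace.uniformContinuous_of_continuous (F t₀).continuous
    obtain ⟨d, hd, hd'⟩ := Metric.uniformContinuous_iff.mp huc (tolerance t₀ / 6) (by positivity)
    refine ⟨d / 2, ?_⟩
    have h1 : ∀ᶠ t in 𝓝 t₀, dist (F t) (F t₀) < tolerance t₀ / 6 :=
      F.continuous.continuousAt.eventually (Metric.ball_mem_nhds _ (by positivity))
    have h2 : ∀ᶠ t in 𝓝 t₀, tolerance t₀ / 2 < tolerance t :=
      continuous_tolerance.continuousAt.eventually (lt_mem_nhds (by linarith))
    filter_upwards [h1, h2] with t ht1 ht2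
    refine ⟨by positivity, fun s s' hs => ?_⟩
    have h3 : dist (F t₀ s) (F t₀ s') < tolerance t₀ / 6 := by
      apply hd'
      rw [Subtype.dist_eq, Real.dist_eq]
      linarith
    have h4 := (ContinuousMap.dist_apply_le_dist (f := F t) (g := F t₀) s).trans_lt ht1
    have h5 := (ContinuousMap.dist_apply_le_dist (f := F t) (g := F t₀) s').trans_lt ht1
    have h6 := dist_triangle4 (F t s) (F t₀ s) (F t₀ s') (F t s')
    rw [dist_comm (F t₀ s') (F t s')] at h6
    have h7 : dist (F t s) (F t s') = ‖u (s, t) - u (s', t)‖ := dist_eq_norm _ _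
    linarith

/-- Running through `S` and `T` fast enough makes them commute with a given path of elements, and
makes countably many defects negligible, at any prescribed continuous rate `D`. -/
lemma exists_reparametrization {v : ℝ≥0 → A} (hv : Continuous v) {S T : ℝ≥0 → A}
    (hST : ∀ t, OrthoIsometries (S t) (T t))
    (hS : ∀ a, Tendsto (fun t => commutatorDefect a (S t)) atTop (𝓝 0)) {p : ℕ → A → ℝ}
    (hp : ∀ k, IsDefect (p k)) (hpS : ∀ k, Tendsto (fun t => p k (S t)) atTop (𝓝 0))
    (hpT : ∀ k, Tendsto (fun t => p k (T t)) atTop (𝓝 0)) {D : ℝ≥0 → ℝ} (hD : Continuous D) :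
    ∃ φ : C(ℝ≥0, ℝ), ∀ t, ∀ r : ℝ≥0, φ t ≤ r →
      ‖v t * S r - S r * v t‖ ≤ tolerance t ∧
      ∀ k : ℕ, (k : ℝ≥0) ≤ t → D t * (p k (S r) + p k (T r)) ≤ tolerance t := by
  refine exists_continuous_forall_mem_convex_of_local_const (t := fun t => {c : ℝ | ∀ r : ℝ≥0,
      c ≤ r → ‖v t * S r - S r * v t‖ ≤ tolerance t ∧
      ∀ k : ℕ, (k : ℝ≥0) ≤ t → D t * (p k (S r) + p k (T r)) ≤ tolerance t})
    (fun t => ?_) (fun t₀ => ?_)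
  · exact Set.OrdConnected.convex ⟨fun c hc _ _ e he r hr => hc r (he.1.trans hr)⟩
  · have hε := tolerance_pos t₀
    obtain ⟨K, hK⟩ := exists_nat_gt (t₀ : ℝ≥0)
    have h1 : ∀ᶠ r in atTop, commutatorDefect (v t₀) (S r) < tolerance t₀ / 6 :=
      (hS (v t₀)).eventually (gt_mem_nhds (by positivity))
    have h2 : ∀ᶠ r in atTop, ∀ k ∈ Finset.range K,
        |D t₀ + 1| * (p k (S r) + p k (T r)) < tolerance t₀ / 2 := by
      rw [eventually_all_finset]
      intro k _
      have h3 := ((hpS k).add (hpT k)).const_mul |D t₀ + 1|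
      rw [add_zero, mul_zero] at h3
      exact h3.eventually (gt_mem_nhds (by positivity))
    obtain ⟨R, hR⟩ := eventually_atTop.mp (h1.and h2)
    refine ⟨R, ?_⟩
    have h3 : ∀ᶠ t in 𝓝 t₀, dist (v t) (v t₀) < tolerance t₀ / 6 :=
      hv.continuousAt.eventually (Metric.ball_mem_nhds _ (by positivity))
    have h4 : ∀ᶠ t in 𝓝 t₀, tolerance t₀ / 2 < tolerance t :=
      continuous_tolerance.continuousAt.eventually (lt_mem_nhds (by linarith))
    have h5 : ∀ᶠ t in 𝓝 t₀, t < (K : ℝ≥0) := gt_mem_nhds hK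
    have h6 : ∀ᶠ t in 𝓝 t₀, D t < D t₀ + 1 :=
      hD.continuousAt.eventually (gt_mem_nhds (by linarith))
    filter_upwards [h3, h4, h5, h6] with t ht3 ht4 ht5 ht6 r hr
    obtain ⟨hr1, hr2⟩ := hR r (by exact_mod_cast hr)
    constructor
    · have h7 := (le_max_left _ _).trans_lt hr1
      have h8 := norm_le_one_of_isometry (hST r).left
      have e : v t * S r - S r * v t =
          ((v t - v t₀) * S r - S r * (v t - v t₀)) - (S r * v t₀ - v t₀ * S r) := by
        noncomm_ring
      rw [dist_eq_norm] at ht3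
      rw [e]
      have h9 : ‖(v t - v t₀) * S r - S r * (v t - v t₀)‖ ≤
          ‖v t - v t₀‖ * 1 + 1 * ‖v t - v t₀‖ :=
        (norm_sub_le _ _).trans (add_le_add ((norm_mul_le _ _).trans (by gcongr))
          ((norm_mul_le _ _).trans (by gcongr)))
      have h10 := norm_sub_le ((v t - v t₀) * S r - S r * (v t - v t₀)) (S r * v t₀ - v t₀ * S r)
      linarith
    · intro k hk
      have hkK : k ∈ Finset.range K := by
        rw [Finset.mem_range]
        exact_mod_cast hk.trans_lt ht5
      have h7 : D t * (p k (S r) + p k (T r)) ≤ |D t₀ + 1| * (p k (S r) + p k (T r)) := by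
        have := (hp k).nonneg (S r)
        have := (hp k).nonneg (T r)
        gcongr
        exact ht6.le.trans (le_abs_self _)
      linarith [hr2 k hkK]

/-- The unitaries entering the swindle at time `t`: the values of `u` at the points
`max (1 - j d) 0`. -/
noncomputable def samples (u : unitInterval × ℝ≥0 → A) (δ : ℝ≥0 → ℝ) (t : ℝ≥0) (j : ℕ) : A :=
  u (Set.projIcc (0 : ℝ) 1 zero_le_one (1 - j * δ t), t)

section
variable {u : unitInterval × ℝ≥0 → A} {δ : ℝ≥0 → ℝ}

omit [CStarAlgebra A] in
lemma samples_zero (t : ℝ≥0) : samples u δ t 0 = u (1, t) := by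
  simp [samples]

lemma samples_eq_one (h0 : ∀ t, u (0, t) = 1) {t : ℝ≥0} (hδ : 0 < δ t) {j : ℕ}
    (hj : 1 / δ t ≤ j) : samples u δ t j = 1 := by
  have h1 : 1 - j * δ t ≤ 0 := by
    rw [div_le_iff₀ hδ] at hj
    linarith
  rw [samples, Set.projIcc_of_le_left _ h1]
  exact h0 t

lemma norm_samples_sub_le {ε : ℝ} {t : ℝ≥0} (hδ : 0 < δ t)
    (h : ∀ s s' : unitInterval, |(s : ℝ) - s'| ≤ δ t → ‖u (s, t) - u (s', t)‖ ≤ ε) (j : ℕ) :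
    ‖samples u δ t (j + 1) - samples u δ t j‖ ≤ ε := by
  refine h _ _ ((Set.abs_projIcc_sub_projIcc _).trans ?_)
  have e : (1 - ((j + 1 : ℕ) : ℝ) * δ t) - (1 - j * δ t) = -δ t := by push_cast; ring
  rw [e, abs_neg, abs_of_pos hδ]

lemma continuous_samples (hu : Continuous u) (hδ : Continuous δ) (j : ℕ) :
    Continuous fun t => samples u δ t j := by
  unfold samples
  exact hu.comp ((continuous_projIcc.comp (by fun_prop)).prodMk continuous_id)

/-- The swindle of the samples does not depend on where it is cut off, so it is continuous in time
although the number of samples grows. -/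
lemma continuous_swindle_samples (hu : Continuous u) (hδ : Continuous δ)
    (h0 : ∀ t, u (0, t) = 1) (hpos : ∀ t, 0 < δ t) {S T : ℝ≥0 → A} (hS : Continuous S)
    (hT : Continuous T) :
    Continuous fun t => swindle (S t) (T t) ⌈1 / δ t⌉₊ (samples u δ t) := by
  refine continuous_iff_continuousAt.mpr fun t₀ => ?_
  have h1 := (continuous_swindle hS hT (⌈1 / δ t₀⌉₊ + 1)
    (continuous_samples hu hδ)).continuousAt (x := t₀)
  refine h1.congr ?_
  have h2 : ContinuousAt (fun t => 1 / δ t) t₀ :=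
    (continuous_const.div hδ fun t => (hpos t).ne').continuousAt
  filter_upwards [h2.eventually (gt_mem_nhds (lt_add_one (1 / δ t₀)))] with t ht
  refine swindle_eq_of_le ?_ fun j hj => samples_eq_one h0 (hpos t) (Nat.ceil_le.mp hj)
  refine Nat.ceil_le.mpr ?_
  push_cast
  linarith [Nat.le_ceil (1 / δ t₀)]

end

/-! ### Shortening a family of paths -/

/-- The homotopy with uniform Lipschitz constant, controlling countably many defects at once. -/
theorem exists_short_homotopy {J : TwoSidedIdeal A} (x : C(unitInterval × ℝ≥0, idealUnitary J))
    {S T : ℝ≥0 → A} (hSc : Continuous S) (hTc : Continuous T)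
    (hST : ∀ t, OrthoIsometries (S t) (T t))
    (hS : ∀ a, Tendsto (fun t => commutatorDefect a (S t)) atTop (𝓝 0)) {p : ℕ → A → ℝ}
    (hp : ∀ k, IsDefect (p k)) (hpS : ∀ k, Tendsto (fun t => p k (S t)) atTop (𝓝 0))
    (hpT : ∀ k, Tendsto (fun t => p k (T t)) atTop (𝓝 0)) :
    ∃ y : C(unitInterval × ℝ≥0, idealUnitary J),
      (∀ t, y (0, t) = x (0, t) ∧ y (1, t) = x (1, t) ∧
        ∀ s s' : unitInterval, dist (y (s, t)) (y (s', t)) ≤ (14 * Real.pi + 4) * dist s s') ∧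
      ∀ k, ∀ η > 0, ∀ᶠ t in atTop, ∀ M, (∀ s, p k (x (s, t)) ≤ M) →
        ∀ s, p k (y (s, t)) ≤ 33 * M + η := by
  -- normalise the paths to start at `1`
  let u : unitInterval × ℝ≥0 → A := fun q => (x q : A) * star (x (0, q.2) : A)
  have hx : Continuous fun q => (x q : A) := continuous_subtype_val.comp x.continuous
  have huc : Continuous u := by fun_prop
  have hu0 : ∀ t, u (0, t) = 1 := fun t => (Unitary.mem_iff.mp (x (0, t)).2.1).2
  have hu : ∀ q, u q ∈ idealUnitary J := fun q =>
    mul_mem_idealUnitary (x q).2 (star_mem_idealUnitary (x _).2)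
  obtain ⟨δ, hδ⟩ := exists_mesh huc
  have hpos := fun t => (hδ t).1
  have hDc : Continuous fun t => 1 / δ t + 2 :=
    (continuous_const.div δ.continuous fun t => (hpos t).ne').add continuous_const
  obtain ⟨φ, hφ⟩ := exists_reparametrization (v := fun t => u (1, t)) (by fun_prop) hST hS hp hpS
    hpT hDc
  let τ : ℝ≥0 → ℝ≥0 := fun t => (φ t).toNNReal
  have hτ : Continuous τ := by fun_prop
  have hφτ : ∀ t, φ t ≤ τ t := fun t => Real.le_coe_toNNReal _
  let Y : ℝ≥0 → A := fun t => swindle (S (τ t)) (T (τ t)) ⌈1 / δ t⌉₊ (samples u δ t)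
  have hYc : Continuous Y := continuous_swindle_samples huc δ.continuous hu0 hpos
    (hSc.comp hτ) (hTc.comp hτ)
  have hY : ∀ t, Y t ∈ idealUnitary J := fun t => swindle_mem (hST _) _ fun j => hu _
  have hYε : ∀ t, ‖Y t - amp (S (τ t)) (u (1, t)) * amp (T (τ t)) (Y t)‖ ≤ tolerance t := by
    intro t
    rw [← samples_zero (u := u) (δ := δ)]
    exact norm_swindle_sub_shift_le (hST _) _ (tolerance_pos t).le
      (fun j hj => samples_eq_one hu0 (hpos t) (Nat.ceil_le.mp hj))
      (norm_samples_sub_le (hpos t) (hδ t).2)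
  have huε : ∀ t, ‖u (1, t) * S (τ t) - S (τ t) * u (1, t)‖ ≤ tolerance t := fun t =>
    (hφ t (τ t) (hφτ t)).1
  let z : unitInterval × ℝ≥0 → A := fun q =>
    shortPath (S (τ q.2)) (T (τ q.2)) (u (1, q.2)) (Y q.2) q.1
  have hzc : Continuous z := by
    have h1 : Continuous fun q : unitInterval × ℝ≥0 =>
        roughPath (S (τ q.2)) (T (τ q.2)) (u (1, q.2)) (Y q.2) (q.1 : ℝ) :=
      continuous_roughPath (by fun_prop) (by fun_prop) (by fun_prop) (by fun_prop) (by fun_prop)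
    have h2 : Continuous fun q : unitInterval × ℝ≥0 =>
        roughPath (S (τ q.2)) (T (τ q.2)) (u (1, q.2)) (Y q.2) 1 :=
      continuous_roughPath (by fun_prop) (by fun_prop) (by fun_prop) (by fun_prop) (by fun_prop)
    refine Continuous.mul (continuous_cayleyPath ?_ ?_ (fun q => ?_) fun q => q.1.2) h1
    · fun_prop
    · fun_prop
    · exact (norm_correction_sub_one_le (hST _) (hu _).1 (hY _).1 (huε _) (hYε _)).trans
        (tolerance_le _)
  have hz : ∀ q, z q ∈ idealUnitary J := fun q =>
    shortPath_mem (hST _) (tolerance_le _) (huε _) (hYε _) (hu _) (hY _) q.1.2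
  refine ⟨⟨fun q => ⟨z q * x (0, q.2), mul_mem_idealUnitary (hz q) (x _).2⟩, by fun_prop⟩,
    fun t => ⟨?_, ?_, fun s s' => ?_⟩, fun k η hη => ?_⟩
  · apply Subtype.ext
    have h1 : z (0, t) = 1 := shortPath_zero (hST _) (hu _).1 (hY _).1
    simp [h1]
  · apply Subtype.ext
    have h1 : z (1, t) = u (1, t) := shortPath_one (hST _) (hu _).1 (hY _).1
    have h2 := (Unitary.mem_iff.mp (x (0, t)).2.1).1
    simp [h1, u, mul_assoc, h2]
  · rw [Subtype.dist_eq, Subtype.dist_eq, dist_eq_norm, Real.dist_eq]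
    simp only [ContinuousMap.coe_mk, ← sub_mul]
    have h1 := norm_le_one_of_unitary (x (0, t)).2.1
    calc _ ≤ ‖z (s, t) - z (s', t)‖ * ‖(x (0, t) : A)‖ := norm_mul_le _ _
      _ ≤ ‖z (s, t) - z (s', t)‖ * 1 := by gcongr
      _ ≤ _ := by
        rw [mul_one]
        exact norm_shortPath_sub_le (hST _) (tolerance_le _) (huε _) (hYε _) (hu _).1 (hY _).1
          s.2 s'.2
  · obtain ⟨C, hC0, hC⟩ := (hp k).bounded
    have h1 := tendsto_tolerance.const_mul (400 + C * 22)
    rw [mul_zero] at h1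
    filter_upwards [h1.eventually (gt_mem_nhds hη), eventually_ge_atTop (k : ℝ≥0)]
      with t ht htk M hM s
    have h2 := (hφ t (τ t) (hφτ t)).2 k htk
    have hM0 := ((hp k).nonneg _).trans (hM 0)
    have hpu : ∀ s, p k (u (s, t)) ≤ 2 * M := by
      intro s
      have h3 := (hp k).mul_le_of_norm_le (norm_le_one_of_unitary (x (s, t)).2.1)
        (norm_le_one_of_unitary (Unitary.star_mem (x (0, t)).2.1))
      rw [(hp k).star_eq] at h3
      linarith [hM s, hM 0]
    have h3 := (hp k).swindle_le (hST (τ t)) ⌈1 / δ t⌉₊ (u := samples u δ t)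
      (fun j => (hu _).1) (by positivity : 0 ≤ 2 * M) fun j => hpu _
    have h4 := (hp k).shortPath_le (hST (τ t)) hC0 hC (tolerance_le t) (huε t) (hYε t)
      (hu (1, t)).1 (hY t).1 s.2
    have h5 := (hp k).mul_le_of_norm_le (norm_le_one_of_unitary (hz (s, t)).1)
      (norm_le_one_of_unitary (x (0, t)).2.1)
    have h6 := hpu 1
    have h7 : (⌈1 / δ t⌉₊ : ℝ) ≤ 1 / δ t + 1 :=
      (Nat.ceil_lt_add_one (by have := hpos t; positivity)).le
    have hσ : 0 ≤ p k (S (τ t)) + p k (T (τ t)) :=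
      add_nonneg ((hp k).nonneg _) ((hp k).nonneg _)
    have h8 : (⌈1 / δ t⌉₊ : ℝ) * (p k (S (τ t)) + p k (T (τ t))) +
        (p k (S (τ t)) + p k (T (τ t))) ≤ tolerance t := by
      refine le_trans ?_ h2
      nlinarith
    have h9 : 0 ≤ (⌈1 / δ t⌉₊ : ℝ) * (p k (S (τ t)) + p k (T (τ t))) := by positivity
    have h10 : p k (z (s, t)) ≤ 4 * p k (u (1, t)) + 12 * p k (Y t) +
      400 * (p k (S (τ t)) + p k (T (τ t))) + C * (22 * tolerance t) := h4
    have h11 : p k (Y t) ≤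
        2 * M + ⌈1 / δ t⌉₊ * (4 * (p k (S (τ t)) + p k (T (τ t)))) := h3
    simp only [ContinuousMap.coe_mk]
    linarith [hM 0]

/-- Passage from asymptotic inequalities at each time to upper limits. -/
lemma limsup_iSup_le {F H : ℝ≥0 → unitInterval → ℝ} {B : ℝ} (hF0 : ∀ t s, 0 ≤ F t s)
    (hH0 : ∀ t s, 0 ≤ H t s) (hH : ∀ t s, H t s ≤ B)
    (h : ∀ η > 0, ∀ᶠ t in atTop, ∀ M, (∀ s, H t s ≤ M) → ∀ s, F t s ≤ 33 * M + η) :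
    limsup (fun t => ⨆ s, F t s) atTop ≤ 243 * limsup (fun t => ⨆ s, H t s) atTop := by
  have hbdd : ∀ t, BddAbove (Set.range (H t)) := fun t => ⟨B, by rintro _ ⟨s, rfl⟩; exact hH t s⟩
  have hle : ∀ t, ⨆ s, H t s ≤ B := fun t => ciSup_le (hH t)
  have hnn : ∀ t, 0 ≤ ⨆ s, H t s := fun t => Real.iSup_nonneg (hH0 t)
  have hbd : IsBoundedUnder (· ≤ ·) atTop fun t => ⨆ s, H t s :=
    isBoundedUnder_of ⟨B, hle⟩
  have hl : 0 ≤ limsup (fun t => ⨆ s, H t s) atTop :=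
    le_limsup_of_frequently_le (Eventually.of_forall hnn).frequently hbd
  have key : limsup (fun t => ⨆ s, F t s) atTop ≤ 33 * limsup (fun t => ⨆ s, H t s) atTop := by
    refine le_of_forall_pos_le_add fun η hη => ?_
    have h1 : ∀ᶠ t in atTop, ⨆ s, H t s < limsup (fun t => ⨆ s, H t s) atTop + η / 34 :=
      eventually_lt_of_limsup_lt (by linarith) hbd
    refine limsup_le_of_le ?_ ?_
    · exact IsBoundedUnder.isCoboundedUnder_le
        (isBoundedUnder_of ⟨0, fun t => Real.iSup_nonneg (hF0 t)⟩)
    · filter_upwards [h1, h (η / 34) (by positivity)] with t ht1 ht2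
      refine ciSup_le fun s => (ht2 _ (fun s => le_ciSup (hbdd t) s) s).trans ?_
      linarith
  linarith

end FlatCentralizer

open FlatCentralizer in
theorem mainTheorem6 {A : Type*} [CStarAlgebra A] [TopologicalSpace.SeparableSpace A]
    (J : TwoSidedIdeal A) (hJ : IsClosed (J : Set A))
    {G : Type*} [Group G] [Countable G] (c : FlatCentralizer.CocycleAction G A)
    (hO : ∃ ι : FlatCentralizer.cuntzInfinity →⋆ₐ[ℂ] c.fixedFlat, Function.Injective ι)
    (x : C(unitInterval × ℝ≥0, FlatCentralizer.idealUnitary J)) :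
    ∃ y : C(unitInterval × ℝ≥0, FlatCentralizer.idealUnitary J),
      (∀ t : ℝ≥0, y (0, t) = x (0, t) ∧ y (1, t) = x (1, t) ∧
        ∃ L : ℝ≥0, (L : ℝ) < 25 * Real.pi ∧ LipschitzWith L (fun s : unitInterval => y (s, t))) ∧
      (∀ a : A,
        limsup (fun t : ℝ≥0 => ⨆ s : unitInterval, ‖(y (s, t) : A) * a - a * (y (s, t) : A)‖) atTop
          ≤ 243 * limsup (fun t : ℝ≥0 =>
              ⨆ s : unitInterval, ‖(x (s, t) : A) * a - a * (x (s, t) : A)‖) atTop) ∧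
      (∀ g : G,
        limsup (fun t : ℝ≥0 => ⨆ s : unitInterval, ‖c.α g (y (s, t) : A) - (y (s, t) : A)‖) atTop
          ≤ 243 * limsup (fun t : ℝ≥0 =>
              ⨆ s : unitInterval, ‖c.α g (x (s, t) : A) - (x (s, t) : A)‖) atTop) := by
  obtain ⟨ι, -⟩ := hO
  obtain ⟨S, T, hSc, hTc, hST, hScomm, hTcomm, hSfix, hTfix⟩ := exists_central_isometries c ι
  -- the commutators with a dense sequence, together with the automorphisms, are countably many
  let q : ℕ ⊕ G → A → ℝ := Sum.elim
    (fun i => commutatorDefect (TopologicalSpace.denseSeq A i)) (fun g b => ‖c.α g b - b‖)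
  have hq : ∀ i, IsDefect (q i) := by
    rintro (i | g)
    · exact isDefect_commutatorDefect _
    · exact isDefect_norm_apply_sub _
  have hqS : ∀ i, Tendsto (fun t => q i (S t)) atTop (𝓝 0) := by
    rintro (i | g)
    · exact hScomm _
    · exact hSfix g
  have hqT : ∀ i, Tendsto (fun t => q i (T t)) atTop (𝓝 0) := by
    rintro (i | g)
    · exact hTcomm _
    · exact hTfix g
  obtain ⟨e, he⟩ := exists_surjective_nat (ℕ ⊕ G)
  obtain ⟨y, hy, hyp⟩ := exists_short_homotopy x hSc hTc hST hScomm (p := fun k => q (e k))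
    (fun k => hq _) (fun k => hqS _) (fun k => hqT _)
  have hyq : ∀ i, ∀ η > 0, ∀ᶠ t in atTop, ∀ M, (∀ s, q i (x (s, t)) ≤ M) →
      ∀ s, q i (y (s, t)) ≤ 33 * M + η := by
    intro i
    obtain ⟨k, rfl⟩ := he i
    exact hyp k
  refine ⟨y, fun t => ⟨(hy t).1, (hy t).2.1, ⟨14 * Real.pi + 4, by positivity⟩, ?_, ?_⟩,
    fun a => ?_, fun g => ?_⟩
  · have := Real.pi_gt_three
    show 14 * Real.pi + 4 < 25 * Real.pi
    linarith
  · exact LipschitzWith.of_dist_le_mul (hy t).2.2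
  · refine limsup_iSup_le (B := 2 * ‖a‖) (fun _ _ => norm_nonneg _) (fun _ _ => norm_nonneg _)
      (fun t s => ?_) fun η hη => ?_
    · have h1 := norm_le_one_of_unitary (x (s, t)).2.1
      calc _ ≤ 1 * ‖a‖ + ‖a‖ * 1 := (norm_sub_le _ _).trans
            (add_le_add ((norm_mul_le _ _).trans (by gcongr)) ((norm_mul_le _ _).trans (by gcongr)))
        _ = _ := by ring
    · -- replacing `a` by a member of the dense sequence costs at most `68` times its distance to `a`
      obtain ⟨i, hi⟩ := Metric.denseRange_iff.mp (TopologicalSpace.denseRange_denseSeq A) a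
        (η / 136) (by positivity)
      rw [dist_eq_norm] at hi
      filter_upwards [hyq (Sum.inl i) (η / 2) (by positivity)] with t ht M hM s
      have h1 : ∀ s, q (Sum.inl i) (x (s, t)) ≤ M + 2 * ‖a - TopologicalSpace.denseSeq A i‖ := by
        intro s
        have h2 := commutatorDefect_le_add (TopologicalSpace.denseSeq A i) a _
          (norm_le_one_of_unitary (x (s, t)).2.1)
        rw [commutatorDefect_of_unitary a (x (s, t)).2.1, norm_sub_rev _ a] at h2
        have h3 : q (Sum.inl i) (x (s, t)) =
          commutatorDefect (TopologicalSpace.denseSeq A i) (x (s, t)) := rfl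
        linarith [hM s]
      have h2 := ht _ h1 s
      have h3 := commutatorDefect_le_add a (TopologicalSpace.denseSeq A i) _
          (norm_le_one_of_unitary (y (s, t)).2.1)
      rw [commutatorDefect_of_unitary a (y (s, t)).2.1] at h3
      have h4 : q (Sum.inl i) (y (s, t)) =
          commutatorDefect (TopologicalSpace.denseSeq A i) (y (s, t)) := rfl
      linarith
  · refine limsup_iSup_le (B := 2) (fun _ _ => norm_nonneg _) (fun _ _ => norm_nonneg _)
      (fun t s => ?_) (hyq (Sum.inr g))
    have h1 := norm_le_one_of_unitary (x (s, t)).2.1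
    refine (norm_sub_le _ _).trans ?_
    rw [norm_starAlgEquiv_apply]
    linarith
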